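/- Consider the deterministic CONGEST model: the nodes of a finite connected simple graph $G=(V,E)$ with $n$ nodes and diameter $D$ have distinct identifiers of $O(\log n)$ bits, all run the same algorithm in synchronous rounds, send at most $O(\log n)$ bits in each direction of each edge in every round, and compute locally at no cost. Let $\mathcal T$ be an arbitrary BFS tree of $G$ with root $r$. At the beginning each node knows its own identifier, those of its neighbours, and its level, its parent (if it is not the root) and its set of ancestors in $\mathcal T$. Notation. For a node $v$, $v^{\downarrow}$ is the set consisting of $v$ and its descendants in $\mathcal T$. For $A,B\subseteq V$, $\delta(A)$ is the set of edges with exactly one endpoint in $A$, $\gamma(A,B)=|\delta(A)\cap\delta(B)|$, and $\eta(v)=|\delta(v^{\downarrow})|$. The canonical tree $R(v^{\downarrow})$ is the union of the tree paths from $r$ to $v$ and from $r$ to every node $y$ for which there is a non-tree edge $(x,y)\in E$ with $x\in v^{\downarrow}$. For a subtree $T'$ of $\mathcal T$ containing $r$, a branch node is a node with at least two children in $T'$, and $x_{T'}$ denotes the branch node closest to $r$, or $r$ if there is none. The branching number of a node $b$ of $T'$ is $\xi_{T'}(b)=1$ if the level of $b$ is at most that of $x_{T'}$, and $\xi_{T'}(b)=\deg_{T'}(p)+\xi_{T'}(p)-2$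 otherwise, where $p$ is the parent of $b$. Let $\mathrm{trunc}(T',k)$ be the subgraph of $T'$ induced by the nodes with branching number at most $k$. The $k$-Sketch of $v$ consists of $R'=\mathrm{trunc}(R(v^{\downarrow}),k)$ together with, for each node $u$ of $R'$, the tuple $\langle u:\eta(u),\mathrm{parent}(u),\gamma(v^{\downarrow},u^{\downarrow})\rangle$ (the parent entry being empty for $u=r$). Statement. For every fixed $k\in\mathbb N$ there is a deterministic CONGEST algorithm which, for every such $G$, $\mathcal T$ and identifiers, terminates after $O(D^2)$ rounds, with every node $v$ knowing its own $k$-Sketch with respect to $\mathcal T$. The constant in $O(D^2)$ depends only on $k$ and on the constant in the bound on the identifier length, and so does the constant in the bound on the message length. -/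

import Mathlib

/-! ### Deterministic synchronous message passing (CONGEST) -/

/-- A deterministic distributed algorithm, the same at every node of every network. `I` is the
initial knowledge of a node and `O` the type of its result. Local computation is free. Nodes
address their neighbours by identifier. A node for which `output` is `some _` has terminated. -/
structure CongestAlgorithm (I O : Type) where
  State : Type
  init : I → State
  /-- The bit string sent to the neighbour with the given identifier (`[]` is silence). -/
  send : State → ℕ → List Bool
  /-- The new state, given the bit string received from the neighbour with each identifier. -/
  step : State → (ℕ → List Bool) → State
  output : State → Option O

namespace CongestAlgorithm

variable {I O : Type} {V : Type*} (A : CongestAlgorithm I O)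

/-- What a node in state `s` sends to the neighbour with identifier `j`; terminated nodes are
silent. -/
def message (s : A.State) (j : ℕ) : List Bool :=
  match A.output s with
  | some _ => []
  | none => A.send s j

open Classical in
/-- The messages that arrive at `v` when the nodes are in the states `σ`: at the identifier of a
neighbour `w`, the message of `w` to `v`; at every other number, nothing. -/
noncomputable def inbox (G : SimpleGraph V) (ident : V → ℕ) (σ : V → A.State) (v : V) (j : ℕ) :
    List Bool :=
  if h : ∃ w, G.Adj v w ∧ ident w = j then A.message (σ h.choose) (ident v) else []

/-- The states of all nodes after `t` rounds; a terminated node does not change any more. -/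
noncomputable def run (G : SimpleGraph V) (ident : V → ℕ) (input : V → I) : ℕ → V → A.State
  | 0, v => A.init (input v)
  | t + 1, v =>
    match A.output (run G ident input t v) with
    | some _ => run G ident input t v
    | none => A.step (run G ident input t v) (A.inbox G ident (run G ident input t) v)

/-- In every round, at most `B` bits are sent in each direction of each link. -/
def HasBandwidth (G : SimpleGraph V) (ident : V → ℕ) (input : V → I) (B : ℕ) : Prop :=
  ∀ t v w, G.Adj v w → (A.message (A.run G ident input t v) (ident w)).length ≤ B

/-- After at most `R` rounds every node `v` has terminated, with the result `result v`. -/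
def ComputesWithin (G : SimpleGraph V) (ident : V → ℕ) (input : V → I) (result : V → O)
    (R : ℕ) : Prop :=
  ∀ v, A.output (A.run G ident input R v) = some (result v)

end CongestAlgorithm

/-! ### Rooted spanning trees -/

namespace RootedTree

variable {V : Type*} (G T : SimpleGraph V) (r : V)

/-- `T` is a breadth-first-search tree of `G` with root `r`. -/
structure IsBFSTree : Prop where
  le : T ≤ G
  isTree : T.IsTree
  dist_eq : ∀ v, T.dist r v = G.dist r v

/-- The depth of `v`. -/
noncomputable def level (v : V) : ℕ := T.dist r v

/-- The path in `T` from the root to `x`, as a subgraph (in a tree there is only one). -/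
def rootPath (x : V) : T.Subgraph := ⨆ p : T.Path r x, (p : T.Walk r x).toSubgraph

/-- The ancestors of `v`, including `v` itself. -/
def ancestors (v : V) : Set V := (rootPath T r v).verts

/-- `v` and its descendants. -/
def desc (v : V) : Set V := {u | v ∈ ancestors T r u}

open Classical in
/-- The parent of `v`; the root has none. -/
noncomputable def parent (v : V) : Option V :=
  if h : ∃ p, T.Adj p v ∧ p ∈ ancestors T r v then some h.choose else none

/-- The edges of `G` that cross the cut `(A, V \ A)`. -/
def cutEdges (A : Set V) : Set (Sym2 V) :=
  {e | e ∈ G.edgeSet ∧ ∃ x ∈ A, ∃ y ∉ A, e = s(x, y)}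

/-- `γ(A, B) = |δ(A) ∩ δ(B)|`. -/
noncomputable def gam (A B : Set V) : ℕ := (cutEdges G A ∩ cutEdges G B).ncard

/-- `η(v) = |δ(v↓)|`. -/
noncomputable def eta (v : V) : ℕ := (cutEdges G (desc T r v)).ncard

/-- The endpoints of non-tree edges that start in `A`. -/
def nonTreeNbrs (A : Set V) : Set V := {y | ∃ x ∈ A, G.Adj x y ∧ ¬ T.Adj x y}

/-- The canonical tree of `v↓`: the union of the root paths of `v` and of all endpoints of
non-tree edges that start in `v↓`. -/
def canonicalTree (v : V) : T.Subgraph :=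
  ⨆ x ∈ insert v (nonTreeNbrs G T (desc T r v)), rootPath T r x

/-! In the following, `T'` is a subtree of `T` that contains the root `r`, so that levels and
parents in `T'` are those in `T`. -/

variable {T} (T' : T.Subgraph)

/-- `b` has at least two children in `T'`. -/
def IsBranchNode (b : V) : Prop := 2 ≤ {c | T'.Adj b c ∧ parent T r c = some b}.ncard

open Classical in
/-- The branch node of `T'` closest to the root, or the root if there is no branch node. -/
noncomputable def firstBranchNode : V :=
  if h : ∃ x, IsBranchNode r T' x ∧ ∀ y, IsBranchNode r T' y → level T r x ≤ level T r y
  then h.choose else r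

/-- Recursion for the branching number along the path to the root; the first argument is a bound
on the number of steps. -/
noncomputable def branchingAux : ℕ → V → ℤ
  | 0, _ => 1
  | m + 1, b =>
    if level T r b ≤ level T r (firstBranchNode r T') then 1
    else match parent T r b with
      | none => 1
      | some p => ((T'.neighborSet p).ncard : ℤ) + branchingAux m p - 2

/-- The branching number of `b` in `T'`: it is `1` if `b` is not deeper than the first branch node,
and otherwise the degree in `T'` of the parent of `b`, plus the branching number of the parent,
minus `2`. The recursion reaches the root after `level b` steps. -/
noncomputable def branchingNumber (b : V) : ℤ := branchingAux r T' (level T r b) b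

/-- The subgraph of `T'` induced by the nodes with branching number at most `k`. -/
noncomputable def trunc (k : ℕ) : T.Subgraph :=
  T'.induce {b | b ∈ T'.verts ∧ branchingNumber r T' b ≤ k}

end RootedTree

/-! ### Sketches -/

/-- A finite graph on identifiers, together with tuples `⟨u : η(u), parent(u), γ(v↓, u↓)⟩`. -/
structure SketchData where
  verts : Finset ℕ
  edges : Finset (Sym2 ℕ)
  info : Finset (ℕ × ℕ × Option ℕ × ℕ)

open RootedTree in
/-- The `k`-Sketch of `v` with respect to the tree `T` rooted at `r`, written with identifiers. -/
noncomputable def kSketch {V : Type*} [Finite V] (G T : SimpleGraph V) (r : V) (ident : V → ℕ)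
    (k : ℕ) (v : V) : SketchData :=
  let R' := trunc r (canonicalTree G T r v) k
  { verts := (Set.toFinite (ident '' R'.verts)).toFinset
    edges := (Set.toFinite (Sym2.map ident '' R'.edgeSet)).toFinset
    info := (Set.toFinite ((fun u => (ident u, eta G T r u, (parent T r u).map ident,
      gam G (desc T r v) (desc T r u))) '' R'.verts)).toFinset }

/-- What a node knows at the beginning: its identifier, the identifiers of its neighbours, its
level, its parent (`none` at the root) and its ancestors in the tree. -/
structure LocalInput where
  ident : ℕ
  nbrs : Finset ℕ
  level : ℕ
  parent : Option ℕ
  ancestors : Finset ℕ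

/-- The initial knowledge of `v` in the network `G` with the tree `T` rooted at `r`. -/
noncomputable def localInput {V : Type*} [Finite V] (G T : SimpleGraph V) (r : V) (ident : V → ℕ)
    (v : V) : LocalInput where
  ident := ident v
  nbrs := (Set.toFinite (ident '' G.neighborSet v)).toFinset
  level := RootedTree.level T r v
  parent := (RootedTree.parent T r v).map ident
  ancestors := (Set.toFinite (ident '' RootedTree.ancestors T r v)).toFinset

/-! ### Rooted trees -/

namespace RootedTree

variable {V : Type*} {G T : SimpleGraph V} {r : V}

/-! A sketch is determined by counts of non-tree edges. Let `vol v` count the ordered non-tree pairs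
(x, y) with x below v, and `cnt v u` those for which moreover y is below u. Two subtrees are nested
or disjoint, and a tree edge lies in both cuts only if u = v, so η and γ are expressed by `vol` and
`cnt` (`eta_eq`, `gam_desc`). Both counts are additive over the children of v (`vol_eq`, `cnt_eq`),
hence computable from the leaves upwards. The canonical tree of v consists of the ancestors of v and
of `supp v`, the nodes u with `cnt v u > 0`; and `supp v` is the union of the supports of the
children of v and the ancestor sets of its non-tree neighbours.

Supports are too large to be sent, so only their cores are: the nodes for which the sum m of (number
of children - 1) over the strict ancestors is at most k. Three facts make this work. The branching
number exceeds m by 0 or 1, so the truncated tree lies in the core and can be recognised there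
(`branchingNumber_le_iff`). Cores can be merged (`IsMerge.reach_iff`): m only decreases in a
parent-closed part, so the core of a union is covered by the cores of the parts, and children
missing from them are signalled by a mark on their parent, which is then "heavy". Cores are small
(`card_core_le`): the weights 2^(k - m) on one level add up to at most 2^k, so a level has at most
2^k core nodes.

Flooding tells all nodes the height H ≤ D of the tree and a common starting round. Then there are 3H
+ 3 blocks of (H + 1) * 2^k rounds, each long enough to broadcast a list of ancestors or a core.
Block 0 announces ancestors and parents. The next H + 1 blocks accumulate `vol v` and `cnt v u`, for
ancestors u of v, towards the root, so that every node obtains its own η. Another H + 1 blocks pass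
parents, η and `vol` of ancestors down the tree and then across the non-tree edges. The last H
blocks merge cores towards the root.

For the correctness, the true messages `msgT` are defined globally, and the local rule is shown to
reproduce them from earlier true messages (`message_blockView`); `run_historyAlgorithm` and
`blockAlgorithm_correct` turn this into a statement about the run. -/

theorem rootPath_eq_toSubgraph (hT : T.IsTree) {x : V} (p : T.Walk r x) (hp : p.IsPath) :
    rootPath T r x = p.toSubgraph := by
  unfold rootPath
  apply le_antisymm
  · refine iSup_le fun q => ?_
    rw [(hT.isAcyclic.subsingleton_path r x).elim q ⟨p, hp⟩]
  · exact le_iSup (fun q : T.Path r x => (q : T.Walk r x).toSubgraph) ⟨p, hp⟩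

theorem mem_ancestors_iff (hT : T.IsTree) {u x : V} (p : T.Walk r x) (hp : p.IsPath) :
    u ∈ ancestors T r x ↔ u ∈ p.support := by
  rw [ancestors, rootPath_eq_toSubgraph hT p hp]
  simp

theorem level_root : level T r r = 0 := by simp [level]

theorem level_eq_zero_iff (hT : T.IsTree) {v : V} : level T r v = 0 ↔ v = r := by
  unfold level
  rw [hT.connected.dist_eq_zero_iff]
  exact eq_comm

theorem ancestors_root (hT : T.IsTree) : ancestors T r r = {r} := by
  ext u
  rw [mem_ancestors_iff hT _ SimpleGraph.Walk.IsPath.nil]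
  simp

theorem exists_isPath_concat (hT : T.IsTree) {p v : V} (h : T.Adj p v)
    (hl : level T r v = level T r p + 1) :
    ∃ q : T.Walk r p, q.IsPath ∧ (q.concat h).IsPath ∧ q.length = level T r p := by
  obtain ⟨q, hq, hlen⟩ := hT.connected.exists_path_of_dist r p
  refine ⟨q, hq, ?_, hlen⟩
  refine hq.concat ?_ h
  intro hmem
  classical
  have h1 := SimpleGraph.dist_le (q.takeUntil v hmem)
  have h2 := q.length_takeUntil_le_length hmem
  unfold level at hl
  omega

theorem ancestors_of_adj (hT : T.IsTree) {p v : V} (h : T.Adj p v)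
    (hl : level T r v = level T r p + 1) :
    ancestors T r v = insert v (ancestors T r p) := by
  obtain ⟨q, hq, hq', -⟩ := exists_isPath_concat hT h hl
  ext u
  rw [mem_ancestors_iff hT _ hq', Set.mem_insert_iff, mem_ancestors_iff hT _ hq,
    SimpleGraph.Walk.support_concat]
  simp [or_comm]

theorem rootPath_adj_of_adj (hT : T.IsTree) {p v : V} (h : T.Adj p v)
    (hl : level T r v = level T r p + 1) (a b : V) :
    (rootPath T r v).Adj a b ↔ (rootPath T r p).Adj a b ∨ s(a, b) = s(p, v) := by
  obtain ⟨q, hq, hq', -⟩ := exists_isPath_concat hT h hl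
  rw [rootPath_eq_toSubgraph hT _ hq', rootPath_eq_toSubgraph hT _ hq]
  rw [← SimpleGraph.Subgraph.mem_edgeSet, ← SimpleGraph.Subgraph.mem_edgeSet,
    SimpleGraph.Walk.mem_edges_toSubgraph, SimpleGraph.Walk.mem_edges_toSubgraph,
    SimpleGraph.Walk.edges_concat]
  simp

theorem self_mem_ancestors (hT : T.IsTree) (v : V) : v ∈ ancestors T r v := by
  obtain ⟨q, hq, -⟩ := hT.connected.exists_path_of_dist r v
  rw [mem_ancestors_iff hT _ hq]
  simp

theorem root_mem_ancestors (hT : T.IsTree) (v : V) : r ∈ ancestors T r v := by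
  obtain ⟨q, hq, -⟩ := hT.connected.exists_path_of_dist r v
  rw [mem_ancestors_iff hT _ hq]
  simp

theorem level_le_of_mem_ancestors (hT : T.IsTree) {u v : V} (h : u ∈ ancestors T r v) :
    level T r u ≤ level T r v := by
  obtain ⟨q, hq, hlen⟩ := hT.connected.exists_path_of_dist r v
  rw [mem_ancestors_iff hT _ hq] at h
  classical
  have h1 := SimpleGraph.dist_le (q.takeUntil u h)
  have h2 := q.length_takeUntil_le_length h
  unfold level
  omega

theorem level_eq_or_of_adj (hT : T.IsTree) {u v : V} (h : T.Adj u v) :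
    level T r u = level T r v + 1 ∨ level T r v = level T r u + 1 := by
  simpa [level] using hT.dist_eq_dist_add_one_of_adj r h

/-- The path to p' prolonged by the edge to v is the path to v, so it contains p. If p were a proper
inner node of the path to p', it would have a smaller level. -/
theorem eq_of_adj_of_level (hT : T.IsTree) {p p' v : V} (h : T.Adj p v)
    (hl : level T r v = level T r p + 1) (h' : T.Adj p' v)
    (hl' : level T r v = level T r p' + 1) : p = p' := by
  have h1 : p ∈ ancestors T r v := by
    rw [ancestors_of_adj hT h hl]; exact Set.mem_insert_of_mem _ (self_mem_ancestors hT p)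
  obtain ⟨q, hq, hq', hlen⟩ := exists_isPath_concat hT h' hl'
  rw [ancestors_of_adj hT h' hl', Set.mem_insert_iff] at h1
  rcases h1 with h1 | h1
  · exact absurd h1 h.ne
  by_contra hne
  rw [mem_ancestors_iff hT _ hq] at h1
  classical
  have h2 := SimpleGraph.dist_le (q.takeUntil p h1)
  have h3 := q.length_takeUntil_lt_length h1 hne
  unfold level at *
  omega

/-- Removes the choice in `parent`; all later arguments about parents use only adjacency and levels.
-/
theorem parent_eq_some_iff (hT : T.IsTree) {p v : V} :
    parent T r v = some p ↔ T.Adj p v ∧ level T r v = level T r p + 1 := by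
  have key : ∀ q, T.Adj q v ∧ q ∈ ancestors T r v ↔ T.Adj q v ∧ level T r v = level T r q + 1 := by
    intro q
    constructor
    · rintro ⟨h, hm⟩
      refine ⟨h, ?_⟩
      have := level_le_of_mem_ancestors hT hm
      rcases level_eq_or_of_adj (r := r) hT h with h' | h' <;> omega
    · rintro ⟨h, hl⟩
      refine ⟨h, ?_⟩
      rw [ancestors_of_adj hT h hl]
      exact Set.mem_insert_of_mem _ (self_mem_ancestors hT q)
  unfold parent
  constructor
  · intro h
    split_ifs at h with hex
    have := (key _).1 hex.choose_spec
    rwa [Option.some.inj h] at this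
  · rintro h
    have hex : ∃ p, T.Adj p v ∧ p ∈ ancestors T r v := ⟨p, (key p).2 h⟩
    rw [dif_pos hex]
    have := (key _).1 hex.choose_spec
    rw [eq_of_adj_of_level hT this.1 this.2 h.1 h.2]

theorem parent_eq_none_iff (hT : T.IsTree) {v : V} : parent T r v = none ↔ v = r := by
  constructor
  · intro h
    by_contra hne
    obtain ⟨q, hq, hlen⟩ := hT.connected.exists_path_of_dist r v
    have hnil : ¬ q.Nil := SimpleGraph.Walk.not_nil_of_ne (Ne.symm hne)
    have hadj := q.adj_penultimate hnil
    have hle : level T r q.penultimate ≤ level T r v := by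
      apply level_le_of_mem_ancestors hT
      rw [mem_ancestors_iff hT _ hq]
      exact q.getVert_mem_support _
    have : parent T r v = some q.penultimate := by
      rw [parent_eq_some_iff hT]
      refine ⟨hadj, ?_⟩
      rcases level_eq_or_of_adj (r := r) hT hadj with h' | h' <;> omega
    rw [h] at this
    cases this
  · rintro rfl
    rw [Option.eq_none_iff_forall_ne_some]
    intro p hp
    have := (parent_eq_some_iff hT).1 hp
    rw [level_root] at this
    omega

theorem parent_root (hT : T.IsTree) : parent T r r = none := (parent_eq_none_iff hT).2 rfl

theorem level_of_parent (hT : T.IsTree) {p v : V} (h : parent T r v = some p) :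
    level T r v = level T r p + 1 := ((parent_eq_some_iff hT).1 h).2

theorem ancestors_of_parent (hT : T.IsTree) {p v : V} (h : parent T r v = some p) :
    ancestors T r v = insert v (ancestors T r p) :=
  have h' := (parent_eq_some_iff hT).1 h
  ancestors_of_adj hT h'.1 h'.2

/-- Induction from the root towards the leaves. -/
theorem induction_parent (hT : T.IsTree) {P : V → Prop} (root : P r)
    (step : ∀ v p, parent T r v = some p → P p → P v) (v : V) : P v := by
  induction hl : level T r v generalizing v with
  | zero => rw [level_eq_zero_iff hT] at hl; exact hl ▸ root
  | succ n ih =>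
    cases hp : parent T r v with
    | none => rw [parent_eq_none_iff hT] at hp; exact hp ▸ root
    | some p => exact step v p hp (ih p (by have := level_of_parent hT hp; omega))

theorem tree_adj_iff (hT : T.IsTree) {x y : V} :
    T.Adj x y ↔ parent T r y = some x ∨ parent T r x = some y := by
  rw [parent_eq_some_iff hT, parent_eq_some_iff hT]
  constructor
  · intro h
    rcases level_eq_or_of_adj (r := r) hT h with h' | h'
    · exact .inr ⟨h.symm, h'⟩
    · exact .inl ⟨h, h'⟩
  · rintro (h | h)
    · exact h.1
    · exact h.1.symm

theorem ancestors_trans (hT : T.IsTree) {u v w : V} (h : u ∈ ancestors T r v) :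
    v ∈ ancestors T r w → u ∈ ancestors T r w := by
  induction w using induction_parent (r := r) hT with
  | root =>
    intro hv
    rw [ancestors_root hT, Set.mem_singleton_iff] at hv
    rwa [hv] at h
  | step w p hp ih =>
    intro hv
    rw [ancestors_of_parent hT hp, Set.mem_insert_iff] at hv
    rcases hv with rfl | hv
    · exact h
    · rw [ancestors_of_parent hT hp]; exact .inr (ih hv)

theorem eq_of_mem_ancestors_of_level (hT : T.IsTree) {u v : V} (h : u ∈ ancestors T r v)
    (hl : level T r v ≤ level T r u) : u = v := by
  cases hp : parent T r v with
  | none =>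
    rw [(parent_eq_none_iff hT).1 hp, ancestors_root hT] at h
    rw [(parent_eq_none_iff hT).1 hp]; exact h
  | some p =>
    rw [ancestors_of_parent hT hp] at h
    rcases h with h | h
    · exact h
    · have := level_le_of_mem_ancestors hT h
      have := level_of_parent hT hp
      omega

theorem ancestors_total (hT : T.IsTree) {u v w : V} (hu : u ∈ ancestors T r w) :
    v ∈ ancestors T r w → u ∈ ancestors T r v ∨ v ∈ ancestors T r u := by
  induction w using induction_parent (r := r) hT with
  | root =>
    intro hv
    rw [ancestors_root hT] at hu hv
    rw [hu, hv]; exact .inl (root_mem_ancestors hT _)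
  | step w p hp ih =>
    intro hv
    have hu' := hu
    have hv' := hv
    rw [ancestors_of_parent hT hp] at hu hv
    rcases hu with rfl | hu
    · exact .inr hv'
    · rcases hv with rfl | hv
      · exact .inl hu'
      · exact ih hu hv

/-- A parent of an ancestor is an ancestor. -/
theorem parent_mem_ancestors (hT : T.IsTree) {u p v : V} (h : u ∈ ancestors T r v)
    (hp : parent T r u = some p) : p ∈ ancestors T r v := by
  refine ancestors_trans hT ?_ h
  rw [ancestors_of_parent hT hp]
  exact .inr (self_mem_ancestors hT p)

theorem rootPath_adj_of_parent (hT : T.IsTree) {c p x : V} (hp : parent T r c = some p)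
    (hc : c ∈ ancestors T r x) : (rootPath T r x).Adj p c := by
  induction x using induction_parent (r := r) hT with
  | root =>
    rw [ancestors_root hT] at hc
    rw [hc, parent_root hT] at hp
    cases hp
  | step x q hq ih =>
    have hq' := (parent_eq_some_iff hT).1 hq
    rw [rootPath_adj_of_adj hT hq'.1 hq'.2]
    rw [ancestors_of_parent hT hq] at hc
    rcases hc with rfl | hc
    · rw [hp] at hq
      cases hq
      exact .inr rfl
    · exact .inl (ih hc)

/-! ### The canonical tree as a parent-closed set of nodes. -/

/-- The nodes of the canonical tree. -/
theorem mem_canonicalTree_verts {v u : V} :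
    u ∈ (canonicalTree G T r v).verts ↔
      u ∈ ancestors T r v ∨ ∃ x ∈ desc T r v, ∃ y, G.Adj x y ∧ ¬ T.Adj x y ∧ u ∈ ancestors T r y := by
  unfold canonicalTree
  simp only [SimpleGraph.Subgraph.verts_iSup, Set.mem_iUnion, Set.mem_insert_iff, nonTreeNbrs,
    Set.mem_ofPred_eq, exists_prop]
  constructor
  · rintro ⟨y, rfl | ⟨x, hx, h1, h2⟩, hu⟩
    · exact .inl hu
    · exact .inr ⟨x, hx, y, h1, h2, hu⟩
  · rintro (hu | ⟨x, hx, y, h1, h2, hu⟩)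
    · exact ⟨v, .inl rfl, hu⟩
    · exact ⟨y, .inr ⟨x, hx, h1, h2⟩, hu⟩

/-- Every tree edge joins a node to its parent, and a root path through a node contains the edge to
its parent. Hence the union of the paths is an induced subgraph, and it suffices to keep track of
its nodes. -/
theorem canonicalTree_adj (hT : T.IsTree) {v a b : V} :
    (canonicalTree G T r v).Adj a b ↔ a ∈ (canonicalTree G T r v).verts ∧
      b ∈ (canonicalTree G T r v).verts ∧ T.Adj a b := by
  constructor
  · intro h
    exact ⟨h.fst_mem, h.snd_mem, h.adj_sub⟩
  · have key : ∀ p c, c ∈ (canonicalTree G T r v).verts → parent T r c = some p →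
        (canonicalTree G T r v).Adj p c := by
      intro p c hc hp
      unfold canonicalTree at hc ⊢
      simp only [SimpleGraph.Subgraph.verts_iSup, Set.mem_iUnion, exists_prop,
        SimpleGraph.Subgraph.iSup_adj] at hc ⊢
      obtain ⟨x, hx, hcx⟩ := hc
      exact ⟨x, hx, rootPath_adj_of_parent hT hp hcx⟩
    rintro ⟨ha, hb, h⟩
    rcases (tree_adj_iff (r := r) hT).1 h with h | h
    · exact key a b hb h
    · exact (key b a ha h).symm

theorem canonicalTree_closed (hT : T.IsTree) {v c p : V}
    (hc : c ∈ (canonicalTree G T r v).verts) (hp : parent T r c = some p) :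
    p ∈ (canonicalTree G T r v).verts := by
  rw [mem_canonicalTree_verts] at hc ⊢
  rcases hc with hc | ⟨x, hx, y, h1, h2, hc⟩
  · exact .inl (parent_mem_ancestors hT hc hp)
  · exact .inr ⟨x, hx, y, h1, h2, parent_mem_ancestors hT hc hp⟩

theorem root_mem_canonicalTree (hT : T.IsTree) (v : V) : r ∈ (canonicalTree G T r v).verts :=
  mem_canonicalTree_verts.2 (.inl (root_mem_ancestors hT v))

end RootedTree

/-! ### Bit encodings of lists of numbers -/

namespace BitCode

/-- A self-delimiting code for bit strings: every bit is preceded by `true`, and `false` ends. -/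
def encodeBits : List Bool → List Bool
  | [] => [false]
  | b :: l => true :: b :: encodeBits l

theorem encodeBits_append_inj {l l' s s' : List Bool}
    (h : encodeBits l ++ s = encodeBits l' ++ s') : l = l' ∧ s = s' := by
  induction l generalizing l' with
  | nil => cases l' <;> simp_all [encodeBits]
  | cons b l ih =>
    cases l' with
    | nil => simp [encodeBits] at h
    | cons b' l' =>
      simp only [encodeBits, List.cons_append, List.cons.injEq, true_and] at h
      have := ih h.2
      simp [h.1, this]

theorem length_encodeBits (l : List Bool) : (encodeBits l).length = 2 * l.length + 1 := by
  induction l with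
  | nil => rfl
  | cons b l ih => simp only [encodeBits, List.length_cons, ih]; omega

/-- A binary code for lists of numbers, with the empty list coded by silence. -/
def encode : List ℕ → List Bool
  | [] => []
  | x :: l => encodeBits x.bits ++ encode l

theorem bits_injective : Function.Injective Nat.bits := by
  intro x y h
  refine Nat.eq_of_testBit_eq fun i => ?_
  rw [Nat.testBit_eq_inth, Nat.testBit_eq_inth, h]

theorem encode_injective : Function.Injective encode := by
  intro l
  induction l with
  | nil =>
    intro l' h
    cases l' with
    | nil => rfl
    | cons x l' => cases hx : x.bits <;> simp [encode, encodeBits, hx] at h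
  | cons x l ih =>
    intro l' h
    cases l' with
    | nil => cases hx : x.bits <;> simp [encode, encodeBits, hx] at h
    | cons y l' =>
      obtain ⟨h1, h2⟩ := encodeBits_append_inj h
      rw [bits_injective h1, ih h2]

/-- The inverse of `encode`. -/
noncomputable def decode : List Bool → List ℕ := Function.invFun encode

theorem decode_encode (l : List ℕ) : decode (encode l) = l :=
  Function.leftInverse_invFun encode_injective l

theorem decode_nil : decode [] = [] := decode_encode []

theorem length_encode_le {l : List ℕ} {s : ℕ} (h : ∀ x ∈ l, x.size ≤ s) :
    (encode l).length ≤ l.length * (2 * s + 1) := by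
  induction l with
  | nil => simp [encode]
  | cons x l ih =>
    have h1 := ih fun y hy => h y (List.mem_cons_of_mem _ hy)
    have h2 := h x List.mem_cons_self
    have h3 : x.bits.length = x.size := Nat.size_eq_bits_len x
    simp only [encode, List.length_append, length_encodeBits, List.length_cons, h3]
    nlinarith

end BitCode

/-! ### Networks and algorithms with full history -/

/-- A network with a breadth-first-search tree. -/
structure Network where
  V : Type*
  [fintype : Fintype V]
  G : SimpleGraph V
  T : SimpleGraph V
  r : V
  ident : V → ℕ
  conn : G.Connected
  bfs : RootedTree.IsBFSTree G T r
  inj : Function.Injective ident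

attribute [instance] Network.fintype

/-- The initial knowledge of a node, the number of rounds so far, and the message received in
each round from each identifier. -/
structure NodeState where
  input : LocalInput
  time : ℕ
  hist : ℕ → ℕ → List ℕ

open BitCode in
/-- The algorithm in which every node remembers everything it has received, broadcasts `snd` of its
state in every round and stops when `out` gives a result. -/
noncomputable def historyAlgorithm {O : Type} (snd : NodeState → List ℕ)
    (out : NodeState → Option O) : CongestAlgorithm LocalInput O where
  State := NodeState
  init i := ⟨i, 0, fun _ _ => []⟩
  send s _ := encode (snd s)
  step s inb := ⟨s.input, s.time + 1, fun t j => if t = s.time then decode (inb j) else s.hist t j⟩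
  output := out

namespace Network

variable (N : Network)

/-- The initial knowledge of a node of the network. -/
noncomputable def input (v : N.V) : LocalInput := localInput N.G N.T N.r N.ident v

open Classical in
/-- The value of `f` at the neighbour of `v` with identifier `j`, or `d` if there is none. -/
noncomputable def heard {α : Type*} (f : N.V → α) (d : α) (v : N.V) (j : ℕ) : α :=
  if h : ∃ w, N.G.Adj v w ∧ N.ident w = j then f h.choose else d

variable {N}

theorem heard_ident {α : Type*} (f : N.V → α) (d : α) {v w : N.V} (h : N.G.Adj v w) :
    N.heard f d v (N.ident w) = f w := by
  have hex : ∃ w', N.G.Adj v w' ∧ N.ident w' = N.ident w := ⟨w, h, rfl⟩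
  rw [heard, dif_pos hex, N.inj hex.choose_spec.2]

theorem heard_of_not {α : Type*} (f : N.V → α) (d : α) {v : N.V} {j : ℕ}
    (h : ¬ ∃ w, N.G.Adj v w ∧ N.ident w = j) : N.heard f d v j = d := dif_neg h

theorem apply_heard {α β : Type*} (g : α → β) (f : N.V → α) (d : α) (v : N.V) (j : ℕ) :
    g (N.heard f d v j) = N.heard (fun w => g (f w)) (g d) v j := by
  unfold heard; split <;> rfl

/-- The state of `v` after `t` rounds if every node `w` has broadcast `M s w` in round `s`. -/
noncomputable def view (M : ℕ → N.V → List ℕ) (t : ℕ) (v : N.V) : NodeState :=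
  ⟨N.input v, t, fun s j => if s < t then N.heard (M s) [] v j else []⟩

open BitCode in
-- The messages `M` are prescribed globally and only have to be locally consistent: if all earlier
-- messages agree with `M`, the state is the view, and by `hsnd` the next message agrees too.
theorem run_historyAlgorithm {O : Type} {snd : NodeState → List ℕ} {out : NodeState → Option O}
    {M : ℕ → N.V → List ℕ} {R : ℕ} (hsnd : ∀ t < R, ∀ v, snd (N.view M t v) = M t v)
    (hout : ∀ t < R, ∀ v, out (N.view M t v) = none) {t : ℕ} (ht : t ≤ R) (v : N.V) :
    (historyAlgorithm snd out).run N.G N.ident N.input t v = N.view M t v := by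
  induction t generalizing v with
  | zero => simp [CongestAlgorithm.run, historyAlgorithm, view]
  | succ t ih =>
    have ih' : (historyAlgorithm snd out).run N.G N.ident N.input t = N.view M t := by
      funext w; exact ih (by omega) w
    have ho : (historyAlgorithm snd out).output (N.view M t v) = none := hout t (by omega) v
    rw [CongestAlgorithm.run, ih', ho]
    simp only [historyAlgorithm, view, NodeState.mk.injEq, true_and]
    funext s j
    by_cases hs : s = t
    · subst hs
      simp only [if_true, Nat.lt_succ_self]
      unfold CongestAlgorithm.inbox heard
      split_ifs with h
      · have ho' : out (N.view M s h.choose) = none := hout s (by omega) _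
        have hs' := hsnd s (by omega) h.choose
        simp only [CongestAlgorithm.message, ho', hs', decode_encode]
      · exact decode_nil
    · have h1 : (s < t + 1) ↔ s < t := by omega
      simp only [hs, if_false, h1]

open BitCode in
/-- If the broadcasts `M` are what `snd` prescribes, and `out` gives the results after exactly `R`
rounds, then the history algorithm computes the results. -/
theorem historyAlgorithm_correct {O : Type} {snd : NodeState → List ℕ}
    {out : NodeState → Option O} {M : ℕ → N.V → List ℕ} {R : ℕ} {res : N.V → O}
    (hsnd : ∀ t < R, ∀ v, snd (N.view M t v) = M t v)
    (hout : ∀ t < R, ∀ v, out (N.view M t v) = none)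
    (hres : ∀ v, out (N.view M R v) = some (res v)) {B R' : ℕ}
    (hB : ∀ t < R, ∀ v, (encode (M t v)).length ≤ B) (hR : R ≤ R') :
    (historyAlgorithm snd out).HasBandwidth N.G N.ident N.input B ∧
      (historyAlgorithm snd out).ComputesWithin N.G N.ident N.input res R' := by
  -- Terminated nodes are frozen, so the result is still there at the later time `R'` and no further
  -- bits are sent.
  have hfin : ∀ t v, (historyAlgorithm snd out).run N.G N.ident N.input (R + t) v
      = N.view M R v := by
    intro t v
    induction t with
    | zero => exact run_historyAlgorithm hsnd hout le_rfl v
    | succ t ih =>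
      have ho : (historyAlgorithm snd out).output (N.view M R v) = some (res v) := hres v
      rw [← add_assoc, CongestAlgorithm.run, ih, ho]
  constructor
  · intro t v w _
    rcases lt_or_ge t R with ht | ht
    · rw [run_historyAlgorithm hsnd hout ht.le v]
      have ho : (historyAlgorithm snd out).output (N.view M t v) = none := hout t ht v
      have hs : (historyAlgorithm snd out).send (N.view M t v) (N.ident w) = encode (M t v) :=
        congrArg encode (hsnd t ht v)
      simp only [CongestAlgorithm.message, ho, hs]
      exact hB t ht v
    · obtain ⟨d, rfl⟩ := Nat.exists_eq_add_of_le ht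
      rw [hfin]
      have ho : (historyAlgorithm snd out).output (N.view M R v) = some (res v) := hres v
      simp [CongestAlgorithm.message, ho]
  · intro v
    obtain ⟨d, rfl⟩ := Nat.exists_eq_add_of_le hR
    rw [hfin]
    exact hres v

end Network

/-! ### Rounds of long broadcasts -/

namespace Network

open RootedTree

variable (N : Network)

/-- The level of a node. -/
noncomputable def lev (v : N.V) : ℕ := level N.T N.r v

/-- The height of the tree. -/
noncomputable def height : ℕ := Finset.univ.sup N.lev

variable {N}

theorem lev_le_height (v : N.V) : N.lev v ≤ N.height := Finset.le_sup (Finset.mem_univ v)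

theorem isTree : N.T.IsTree := N.bfs.isTree

theorem mem_input_nbrs {v : N.V} {j : ℕ} :
    j ∈ (N.input v).nbrs ↔ ∃ w, N.G.Adj v w ∧ N.ident w = j := by
  simp [input, localInput]

theorem ident_mem_input_nbrs {v w : N.V} (h : N.G.Adj v w) : N.ident w ∈ (N.input v).nbrs :=
  mem_input_nbrs.2 ⟨w, h, rfl⟩

theorem adj_of_parent {v p : N.V} (h : parent N.T N.r v = some p) : N.G.Adj v p :=
  N.bfs.le ((parent_eq_some_iff isTree).1 h).1.symm

theorem exists_lev_eq {v : N.V} {s d : ℕ} (h : N.lev v = s + d) : ∃ u, N.lev u = s := by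
  induction d generalizing v with
  | zero => exact ⟨v, h⟩
  | succ d ih =>
    cases hp : parent N.T N.r v with
    | none =>
      rw [(parent_eq_none_iff isTree).1 hp, lev, level_root] at h
      omega
    | some p =>
      have := level_of_parent isTree hp
      exact ih (v := p) (by unfold lev at *; omega)

theorem exists_lev_eq_of_le {s : ℕ} (h : s ≤ N.height) : ∃ u, N.lev u = s := by
  obtain ⟨v, -, hv⟩ := Finset.exists_mem_eq_sup Finset.univ ⟨N.r, Finset.mem_univ _⟩ N.lev
  refine exists_lev_eq (v := v) (d := N.height - s) ?_
  have : N.height = N.lev v := hv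
  omega

/-! ### Computing the height by flooding. -/

variable (N) in
/-- The largest level that `v` has heard of after `t` rounds of flooding. -/
noncomputable def maxLev : ℕ → N.V → ℕ
  | 0, v => N.lev v
  | t + 1, v => max (N.lev v) ((N.input v).nbrs.sup (N.heard (maxLev t) 0 v))

theorem maxLev_le_height (t : ℕ) (v : N.V) : N.maxLev t v ≤ N.height := by
  induction t generalizing v with
  | zero => exact lev_le_height v
  | succ t ih =>
    refine max_le (lev_le_height v) (Finset.sup_le fun j hj => ?_)
    obtain ⟨w, hw, rfl⟩ := mem_input_nbrs.1 hj
    rw [heard_ident _ _ hw]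
    exact ih w

theorem lev_le_maxLev {v w : N.V} (p : N.G.Walk v w) : N.lev w ≤ N.maxLev p.length v := by
  induction p with
  | nil => exact le_rfl
  | @cons a b c h p ih =>
    refine ih.trans (le_max_of_le_right ?_)
    have := Finset.le_sup (f := N.heard (N.maxLev p.length) 0 a) (ident_mem_input_nbrs h)
    rwa [heard_ident _ _ h] at this

/-- If the height exceeds s, some node has level s + 1. In a BFS tree this is its distance from the
root in the network, so its level has reached the root after s + 1 rounds. Thus silence about levels
above s is conclusive. -/
theorem sup_heard_maxLev_root_le_iff (s : ℕ) :
    (N.input N.r).nbrs.sup (N.heard (N.maxLev s) 0 N.r) ≤ s ↔ N.height ≤ s := by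
  have h0 : N.lev N.r = 0 := level_root
  have h1 : (N.input N.r).nbrs.sup (N.heard (N.maxLev s) 0 N.r) = N.maxLev (s + 1) N.r := by
    simp [maxLev, h0]
  rw [h1]
  constructor
  · intro h
    by_contra! hlt
    obtain ⟨u, hu⟩ := exists_lev_eq_of_le (N := N) (s := s + 1) hlt
    obtain ⟨p, hp⟩ := N.conn.exists_walk_length_eq_dist N.r u
    have h2 := lev_le_maxLev p
    rw [hp, ← N.bfs.dist_eq] at h2
    change N.lev u ≤ N.maxLev (N.lev u) N.r at h2
    rw [hu] at h2
    omega
  · exact (maxLev_le_height _ _).trans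

variable (N) in
/-- The broadcast in round `t` of the computation of the height: the largest level heard of, and
whether the height is known. -/
noncomputable def floodMsg (t : ℕ) (v : N.V) : List ℕ :=
  [N.maxLev t v, if N.height + 1 + N.lev v ≤ t then 1 else 0]

variable (N) in
/-- First the height is computed. Then, in blocks of `L` rounds, the elements of `Y i v` are
broadcast one by one, for `i = 0, 1, …`. -/
noncomputable def blockMsg (Y : ℕ → N.V → Finset (List ℕ)) (L t : ℕ) (v : N.V) : List ℕ :=
  if t < 2 * N.height + 1 then N.floodMsg t v
  else (Y ((t - (2 * N.height + 1)) / L) v).toList.getD ((t - (2 * N.height + 1)) % L) []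

end Network

/-- The height of the tree, the initial knowledge of a node, and the set of messages received in
each block of rounds from each identifier. -/
structure BlockState where
  height : ℕ
  input : LocalInput
  hist : ℕ → ℕ → Finset (List ℕ)

namespace NodeState

/-- The event that tells a node the height: for the root, no level above `s` has been heard of in
round `s`; for the other nodes, the parent knows the height in round `s`. -/
def Signal (st : NodeState) (s : ℕ) : Prop :=
  s < st.time ∧ match st.input.parent with
    | none => (st.input.nbrs.sup fun j => (st.hist s j).getD 0 0) ≤ s
    | some p => (st.hist s p).getD 1 0 = 1

/-- The height, computed from the time of the first signal. -/
noncomputable def height (st : NodeState) : ℕ := sInf {s | st.Signal s} - st.input.level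

/-- The messages of the first `i` blocks of length `L`, when the height is `H`. -/
noncomputable def blocks (st : NodeState) (L H i : ℕ) : BlockState :=
  ⟨H, st.input, fun i' j =>
    if i' < i then
      ((Finset.range L).image fun q => st.hist (2 * H + 1 + i' * L + q) j).erase []
    else ∅⟩

open Classical in
/-- The broadcast of a node that sends `msg i` in block `i`. -/
noncomputable def blockSend (L : ℕ → ℕ) (msg : ℕ → BlockState → Finset (List ℕ))
    (st : NodeState) : List ℕ :=
  if (∃ s, st.Signal s) ∧ 2 * st.height + 1 ≤ st.time then
    let i := (st.time - (2 * st.height + 1)) / L st.height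
    (msg i (st.blocks (L st.height) st.height i)).toList.getD
      ((st.time - (2 * st.height + 1)) % L st.height) []
  else
    [if st.time = 0 then st.input.level else
      max st.input.level (st.input.nbrs.sup fun j => (st.hist (st.time - 1) j).getD 0 0),
      if ∃ s, st.Signal s then 1 else 0]

open Classical in
/-- The result after `n` blocks of rounds; at once if there are no neighbours. -/
noncomputable def blockOut {O : Type} (L n : ℕ → ℕ) (fin : BlockState → O)
    (st : NodeState) : Option O :=
  if st.input.nbrs = ∅ then some (fin ⟨0, st.input, fun _ _ => ∅⟩)
  else if (∃ s, st.Signal s) ∧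
      2 * st.height + 1 + n st.height * L st.height ≤ st.time then
    some (fin (st.blocks (L st.height) st.height (n st.height)))
  else none

end NodeState

namespace Network

open RootedTree

variable {N : Network}

/-- The state of `v` before block `i` if every node `w` has broadcast `Y i' w` in block `i'`. -/
noncomputable def blockView (Y : ℕ → N.V → Finset (List ℕ)) (i : ℕ) (v : N.V) : BlockState :=
  ⟨N.height, N.input v, fun i' j => if i' < i then N.heard (Y i') ∅ v j else ∅⟩

/-- The root gets its first signal in round `height`, and every level one round later than the level
above. The bound on s restricts to the rounds in which flooding messages are sent; since levels are
at most the height, all first signals occur there. -/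
theorem signal_view_iff {Y : ℕ → N.V → Finset (List ℕ)} {L t s : ℕ} {v : N.V}
    (hs : s ≤ 2 * N.height) :
    (N.view (N.blockMsg Y L) t v).Signal s ↔ s < t ∧ N.height + N.lev v ≤ s := by
  unfold NodeState.Signal
  refine and_congr_right fun hst => ?_
  change s < t at hst
  have hM : N.blockMsg Y L s = N.floodMsg s := by
    funext w; rw [blockMsg, if_pos (by omega)]
  cases hp : parent N.T N.r v with
  | none =>
    have hv := (parent_eq_none_iff isTree).1 hp
    have h1 : (N.view (N.blockMsg Y L) t v).input.parent = none := by
      simp [view, input, localInput, hp]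
    rw [h1, hv]
    have h0 : N.lev N.r = 0 := level_root
    rw [h0, Nat.add_zero, ← sup_heard_maxLev_root_le_iff]
    simp only [view, hst, if_true, hM]
    have : (fun j => (N.heard (N.floodMsg s) [] N.r j).getD 0 0) = N.heard (N.maxLev s) 0 N.r := by
      funext j
      exact apply_heard (fun l : List ℕ => l.getD 0 0) _ _ _ _
    rw [this]
  | some p =>
    have h1 : (N.view (N.blockMsg Y L) t v).input.parent = some (N.ident p) := by
      simp [view, input, localInput, hp]
    rw [h1]
    simp only [view, hst, if_true, hM]
    rw [heard_ident _ _ (adj_of_parent hp)]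
    have : N.lev v = N.lev p + 1 := level_of_parent isTree hp
    simp only [floodMsg, List.getD_cons_succ, List.getD_cons_zero]
    split_ifs <;> simp <;> omega

theorem exists_signal_view_iff {Y : ℕ → N.V → Finset (List ℕ)} {L t : ℕ} {v : N.V} :
    (∃ s, (N.view (N.blockMsg Y L) t v).Signal s) ↔ N.height + N.lev v < t := by
  have hl := lev_le_height v
  constructor
  · rintro ⟨s, hs⟩
    by_cases h : s ≤ 2 * N.height
    · have := (signal_view_iff h).1 hs
      omega
    · have : s < t := hs.1
      omega
  · intro h
    exact ⟨N.height + N.lev v, (signal_view_iff (by omega)).2 ⟨h, le_rfl⟩⟩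

/-- Later block messages may accidentally look like signals; this is harmless because only the
earliest signal is used. -/
theorem height_view {Y : ℕ → N.V → Finset (List ℕ)} {L t : ℕ} {v : N.V}
    (h : N.height + N.lev v < t) : (N.view (N.blockMsg Y L) t v).height = N.height := by
  have hl := lev_le_height v
  have h1 : sInf {s | (N.view (N.blockMsg Y L) t v).Signal s} = N.height + N.lev v := by
    have hmem : N.height + N.lev v ∈ {s | (N.view (N.blockMsg Y L) t v).Signal s} :=
      (signal_view_iff (by omega)).2 ⟨h, le_rfl⟩
    refine le_antisymm (Nat.sInf_le hmem) ?_
    have h2 := Nat.sInf_mem ⟨_, hmem⟩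
    have h3 := Nat.sInf_le hmem
    exact ((signal_view_iff (by omega)).1 h2).2
  have h2 : (N.view (N.blockMsg Y L) t v).input.level = N.lev v := rfl
  rw [NodeState.height, h1, h2]
  omega

/-- After the last element of the set the default `[]` is sent, that is, silence, which the receiver
erases. Therefore `[]` must not be an element. -/
theorem image_range_getD_toList {S : Finset (List ℕ)} {L : ℕ} (hnil : [] ∉ S)
    (hcard : S.card ≤ L) :
    ((Finset.range L).image fun q => S.toList.getD q []).erase [] = S := by
  ext x
  rw [Finset.mem_erase, Finset.mem_image]
  constructor
  · rintro ⟨hx, q, -, rfl⟩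
    rw [← Finset.mem_toList]
    by_cases hq : q < S.toList.length
    · rw [List.getD_eq_getElem _ _ hq]
      exact List.getElem_mem hq
    · rw [List.getD_eq_default _ _ (by omega)] at hx
      exact absurd rfl hx
  · intro hx
    refine ⟨fun h => hnil (h ▸ hx), ?_⟩
    rw [← Finset.mem_toList] at hx
    obtain ⟨q, hq, rfl⟩ := List.getElem_of_mem hx
    refine ⟨q, ?_, List.getD_eq_getElem _ _ hq⟩
    rw [Finset.length_toList] at hq
    simp only [Finset.mem_range]
    omega

theorem blocks_view {Y : ℕ → N.V → Finset (List ℕ)} {L t i : ℕ} {v : N.V}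
    (hnil : ∀ i v, [] ∉ Y i v) (hcard : ∀ i v, (Y i v).card ≤ L)
    (ht : 2 * N.height + 1 + i * L ≤ t) :
    (N.view (N.blockMsg Y L) t v).blocks L N.height i = N.blockView Y i v := by
  unfold NodeState.blocks blockView
  simp only [BlockState.mk.injEq, true_and]
  refine ⟨rfl, ?_⟩
  funext i' j
  split_ifs with hi
  swap
  · rfl
  by_cases hj : ∃ w, N.G.Adj v w ∧ N.ident w = j
  · obtain ⟨w, hw, rfl⟩ := hj
    rw [heard_ident _ _ hw, ← image_range_getD_toList (hnil i' w) (hcard i' w)]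
    congr 1
    refine Finset.image_congr fun q hq => ?_
    have hq : q < L := by simpa using hq
    have h1 : i' * L + q < i * L := by nlinarith
    simp only [view]
    rw [if_pos (by omega), heard_ident _ _ hw, blockMsg, if_neg (by omega)]
    have h2 : 2 * N.height + 1 + i' * L + q - (2 * N.height + 1) = L * i' + q := by
      rw [mul_comm L i']; omega
    rw [h2, Nat.mul_add_div (by omega), Nat.mul_add_mod, Nat.div_eq_of_lt hq, Nat.mod_eq_of_lt hq,
      Nat.add_zero]
  · rw [heard_of_not _ _ hj]
    ext x
    simp only [view, heard_of_not _ _ hj, ite_self, Finset.mem_erase, Finset.mem_image]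
    simp only [Finset.notMem_empty, iff_false, not_and, not_exists]
    rintro hx q - rfl
    exact hx rfl

/-- Every node knows the height after round height + level ≤ 2 * height, so all nodes leave the
flooding phase in the same round 2 * height + 1 and agree on the block boundaries. -/
theorem blockSend_view {Y : ℕ → N.V → Finset (List ℕ)} {L n : ℕ → ℕ}
    {msg : ℕ → BlockState → Finset (List ℕ)}
    (hmsg : ∀ i < n N.height, ∀ v, msg i (N.blockView Y i v) = Y i v)
    (hnil : ∀ i v, [] ∉ Y i v) (hcard : ∀ i v, (Y i v).card ≤ L N.height) {t : ℕ}
    (ht : t < 2 * N.height + 1 + n N.height * L N.height) (v : N.V) :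
    (N.view (N.blockMsg Y (L N.height)) t v).blockSend L msg = N.blockMsg Y (L N.height) t v := by
  have hl := lev_le_height v
  unfold NodeState.blockSend
  rw [exists_signal_view_iff]
  have htime : (N.view (N.blockMsg Y (L N.height)) t v).time = t := rfl
  rw [htime]
  by_cases h : 2 * N.height + 1 ≤ t
  · have h1 : N.height + N.lev v < t := by omega
    rw [height_view h1, if_pos ⟨h1, h⟩]
    obtain ⟨d, rfl⟩ := Nat.exists_eq_add_of_le h
    have h2 : d < n N.height * L N.height := by omega
    have h3 : d / L N.height < n N.height := Nat.div_lt_of_lt_mul (by rwa [mul_comm])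
    have h4 : d / L N.height * L N.height ≤ d := Nat.div_mul_le_self _ _
    simp only [Nat.add_sub_cancel_left]
    rw [blocks_view hnil hcard (by omega), hmsg _ h3, blockMsg, if_neg (by omega),
      Nat.add_sub_cancel_left]
  · rw [if_neg]
    · have hrhs : N.blockMsg Y (L N.height) t v = N.floodMsg t v := if_pos (by omega)
      rw [hrhs, floodMsg]
      congr 1
      · cases t with
        | zero => rfl
        | succ t =>
          simp only [view, Nat.succ_ne_zero, if_false, Nat.add_sub_cancel, Nat.lt_succ_self, if_true]
          have hM : N.blockMsg Y (L N.height) t = N.floodMsg t := by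
            funext w; rw [blockMsg, if_pos (by omega)]
          rw [hM, maxLev]
          have : (fun j => (N.heard (N.floodMsg t) [] v j).getD 0 0) =
              N.heard (N.maxLev t) 0 v := by
            funext j
            exact apply_heard (fun l : List ℕ => l.getD 0 0) _ _ _ _
          rw [this]
          rfl
      · have : N.height + N.lev v < t ↔ N.height + 1 + N.lev v ≤ t := by omega
        simp only [this]
    · rintro ⟨h1, h2⟩
      rw [height_view h1] at h2
      exact h h2

open BitCode in
/-- Broadcasts in blocks can be realized by a history algorithm. -/
theorem blockAlgorithm_correct {O : Type} {Y : ℕ → N.V → Finset (List ℕ)} {L n : ℕ → ℕ}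
    {msg : ℕ → BlockState → Finset (List ℕ)} {fin : BlockState → O} {res : N.V → O} {B R : ℕ}
    (hmsg : ∀ i < n N.height, ∀ v, msg i (N.blockView Y i v) = Y i v)
    (hfin : ∀ v, fin (N.blockView Y (n N.height) v) = res v)
    (hnil : ∀ i v, [] ∉ Y i v) (hcard : ∀ i v, (Y i v).card ≤ L N.height)
    (hB : ∀ i v, ∀ l ∈ Y i v, (encode l).length ≤ B)
    (hB' : ∀ t v, (encode (N.floodMsg t v)).length ≤ B)
    (hR : Nontrivial N.V → 2 * N.height + 1 + n N.height * L N.height ≤ R) :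
    (historyAlgorithm (NodeState.blockSend L msg) (NodeState.blockOut L n fin)).HasBandwidth
        N.G N.ident N.input B ∧
      (historyAlgorithm (NodeState.blockSend L msg) (NodeState.blockOut L n fin)).ComputesWithin
        N.G N.ident N.input res R := by
  -- A single node has diameter 0, so the final bound leaves no round at all: it must have
  -- terminated initially, which `blockOut` provides for nodes without neighbours.
  cases subsingleton_or_nontrivial N.V with
  | inl hss =>
    have hno : ∀ v w : N.V, ¬ N.G.Adj v w := fun v w h => h.ne (Subsingleton.elim _ _)
    have hnb : ∀ v, (N.input v).nbrs = ∅ := by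
      intro v
      ext j
      rw [mem_input_nbrs]
      simp [hno]
    have hh : N.height = 0 := by
      refine Nat.le_zero.1 (Finset.sup_le fun v _ => ?_)
      rw [Subsingleton.elim v N.r, lev, level_root]
    refine historyAlgorithm_correct (M := N.blockMsg Y (L N.height)) (R := 0)
      (by simp) (by simp) (fun v => ?_) (by simp) (Nat.zero_le _)
    have h1 : (N.view (N.blockMsg Y (L N.height)) 0 v).input.nbrs = ∅ := hnb v
    rw [NodeState.blockOut, if_pos h1, ← hfin v]
    congr 2
    unfold blockView
    simp only [BlockState.mk.injEq]
    refine ⟨hh.symm, rfl, ?_⟩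
    funext i j
    rw [heard_of_not _ _ (by simp [hno]), ite_self]
  | inr hnt =>
    have hnb : ∀ v, (N.input v).nbrs ≠ ∅ := by
      intro v h
      obtain ⟨w, hw⟩ := N.conn.preconnected.exists_adj_of_nontrivial v
      have := ident_mem_input_nbrs hw
      rw [h] at this
      simp at this
    have hex : ∀ t v, (N.view (N.blockMsg Y (L N.height)) t v).blockOut L n fin =
        if 2 * N.height + 1 + n N.height * L N.height ≤ t then
          some (fin ((N.view (N.blockMsg Y (L N.height)) t v).blocks
            (L N.height) N.height (n N.height)))
        else none := by
      intro t v
      have hl := lev_le_height v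
      have h1 : (N.view (N.blockMsg Y (L N.height)) t v).input.nbrs ≠ ∅ := hnb v
      have htime : (N.view (N.blockMsg Y (L N.height)) t v).time = t := rfl
      rw [NodeState.blockOut, if_neg h1, exists_signal_view_iff, htime]
      by_cases h : N.height + N.lev v < t
      · rw [height_view h]
        simp only [h, true_and]
      · rw [if_neg (fun h' => h h'.1), if_neg]
        intro h'
        omega
    refine historyAlgorithm_correct (M := N.blockMsg Y (L N.height))
      (R := 2 * N.height + 1 + n N.height * L N.height)
      (fun t ht v => blockSend_view hmsg hnil hcard ht v) (fun t ht v => ?_) (fun v => ?_)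
      (fun t _ v => ?_) (hR hnt)
    · rw [hex, if_neg (by omega)]
    · rw [hex, if_pos le_rfl, blocks_view hnil hcard le_rfl, hfin]
    · unfold blockMsg
      split_ifs with h
      · exact hB' t v
      · by_cases hq : (t - (2 * N.height + 1)) % L N.height <
            (Y ((t - (2 * N.height + 1)) / L N.height) v).toList.length
        · rw [List.getD_eq_getElem _ _ hq]
          exact hB _ v _ (Finset.mem_toList.1 (List.getElem_mem hq))
        · rw [List.getD_eq_default _ _ (by omega)]
          exact Nat.zero_le _

end Network

/-! ### Tables of numbers -/

namespace Table

/-- The table with the row `g j` at each key `j ∈ S`. -/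
def table (S : Finset ℕ) (g : ℕ → List ℕ) : Finset (List ℕ) := S.image fun j => j :: g j

/-- The keys of a table. -/
def keys (D : Finset (List ℕ)) : Finset ℕ := D.image fun l => l.headD 0

open Classical in
/-- The row of a table at the key `j`, or `[]` if there is none. -/
noncomputable def row (D : Finset (List ℕ)) (j : ℕ) : List ℕ :=
  if h : ∃ l, j :: l ∈ D then h.choose else []

/-- The entry of a table at the key `j` in column `i`, or `0` if there is none. -/
noncomputable def entry (D : Finset (List ℕ)) (j i : ℕ) : ℕ := (row D j).getD i 0

theorem keys_table (S : Finset ℕ) (g : ℕ → List ℕ) : keys (table S g) = S := by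
  simp [keys, table, Finset.image_image, Function.comp_def]

theorem row_table {S : Finset ℕ} {g : ℕ → List ℕ} {j : ℕ} (h : j ∈ S) :
    row (table S g) j = g j := by
  have hex : ∃ l, j :: l ∈ table S g := ⟨g j, Finset.mem_image.2 ⟨j, h, rfl⟩⟩
  rw [row, dif_pos hex]
  obtain ⟨i, -, hi⟩ := Finset.mem_image.1 hex.choose_spec
  rw [List.cons.injEq] at hi
  rw [← hi.2, hi.1]

theorem row_table_of_notMem {S : Finset ℕ} {g : ℕ → List ℕ} {j : ℕ} (h : j ∉ S) :
    row (table S g) j = [] := by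
  rw [row, dif_neg]
  rintro ⟨l, hl⟩
  obtain ⟨i, hi, hil⟩ := Finset.mem_image.1 hl
  rw [List.cons.injEq] at hil
  exact h (hil.1 ▸ hi)

theorem entry_table {S : Finset ℕ} {g : ℕ → List ℕ} {j : ℕ} (h : j ∈ S) (i : ℕ) :
    entry (table S g) j i = (g j).getD i 0 := by rw [entry, row_table h]

theorem entry_table_of_notMem {S : Finset ℕ} {g : ℕ → List ℕ} {j : ℕ} (h : j ∉ S) (i : ℕ) :
    entry (table S g) j i = 0 := by rw [entry, row_table_of_notMem h]; rfl

theorem nil_notMem_table (S : Finset ℕ) (g : ℕ → List ℕ) : [] ∉ table S g := by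
  simp [table]

theorem card_table_le (S : Finset ℕ) (g : ℕ → List ℕ) : (table S g).card ≤ S.card :=
  Finset.card_image_le

/-- In a union of tables from several senders a key can have several rows. The choice made by `row`
does not matter in a column where they all agree. -/
theorem entry_eq_of_forall {D : Finset (List ℕ)} {b c x : ℕ} (h : ∃ l, b :: l ∈ D)
    (hD : ∀ l, b :: l ∈ D → l.getD c 0 = x) : entry D b c = x := by
  rw [entry, row, dif_pos h]
  exact hD _ h.choose_spec

theorem cons_mem_table_iff {S : Finset ℕ} {g : ℕ → List ℕ} {b : ℕ} {l : List ℕ} :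
    b :: l ∈ table S g ↔ b ∈ S ∧ l = g b := by
  simp only [table, Finset.mem_image, List.cons.injEq]
  exact ⟨fun ⟨j, hj, h1, h2⟩ => h1 ▸ ⟨hj, h2.symm⟩, fun ⟨h1, h2⟩ => ⟨b, h1, rfl, h2.symm⟩⟩

theorem table_congr {S S' : Finset ℕ} {g g' : ℕ → List ℕ} (hS : S = S')
    (hg : ∀ j ∈ S', g j = g' j) : table S g = table S' g' := by
  subst hS
  exact Finset.image_congr fun j hj => by rw [hg j hj]

end Table

/-! ### Truncation of forests given by parent pointers -/

namespace Forest

variable {P P' : ℕ → Option ℕ} {T T' : Finset ℕ} {NF : Set ℕ} {k : ℕ}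

/-- The children of `p` in `T`, where `P` gives the parents. -/
def kids (P : ℕ → Option ℕ) (T : Finset ℕ) (p : ℕ) : Finset ℕ := T.filter fun c => P c = some p

/-- `Reach P T NF k b A m`: the node `b` of `T` has the set of ancestors `A`, the sum of
`|kids p| - 1` over the strict ancestors `p` of `b` is `m ≤ k`, and none of these is in `NF`. -/
inductive Reach (P : ℕ → Option ℕ) (T : Finset ℕ) (NF : Set ℕ) (k : ℕ) :
    ℕ → Finset ℕ → ℕ → Prop
  | root {b : ℕ} : b ∈ T → P b = none → Reach P T NF k b {b} 0
  | step {p c m : ℕ} {A : Finset ℕ} : Reach P T NF k p A m → p ∉ NF → c ∈ T → P c = some p →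
      m + (kids P T p).card ≤ k + 1 → Reach P T NF k c (insert c A) (m + (kids P T p).card - 1)

/-- The nodes of `T` with a sum of at most `k`. -/
def InCore (P : ℕ → Option ℕ) (T : Finset ℕ) (k b : ℕ) : Prop := ∃ A m, Reach P T ∅ k b A m

/-- The nodes in the core whose children are not in the core, because there are too many. -/
def Heavy (P : ℕ → Option ℕ) (T : Finset ℕ) (k b : ℕ) : Prop :=
  ∃ A m, Reach P T ∅ k b A m ∧ k + 1 < m + (kids P T b).card

/-- `T` contains the parents of its nodes. -/
def Closed (P : ℕ → Option ℕ) (T : Finset ℕ) : Prop := ∀ c ∈ T, ∀ p, P c = some p → p ∈ T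

theorem Reach.mem {b m : ℕ} {A : Finset ℕ} (h : Reach P T NF k b A m) : b ∈ T := by
  cases h <;> assumption

theorem kids_mono (h : T ⊆ T') (p : ℕ) : kids P T p ⊆ kids P T' p :=
  Finset.filter_subset_filter _ h

theorem one_le_card_kids {c p : ℕ} (hc : c ∈ T) (hp : P c = some p) :
    1 ≤ (kids P T p).card :=
  Finset.card_pos.2 ⟨c, Finset.mem_filter.2 ⟨hc, hp⟩⟩

theorem Reach.le {b m : ℕ} {A : Finset ℕ} (h : Reach P T NF k b A m) : m ≤ k := by
  cases h with
  | root => exact Nat.zero_le _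
  | step => omega

theorem Reach.unique {b m m' : ℕ} {A A' : Finset ℕ} (h : Reach P T NF k b A m)
    (h' : Reach P T NF k b A' m') : A = A' ∧ m = m' := by
  induction h generalizing A' m' with
  | root _ hb =>
    cases h' with
    | root => exact ⟨rfl, rfl⟩
    | step _ _ _ hc => rw [hb] at hc; cases hc
  | step _ _ _ hc _ ih =>
    cases h' with
    | root _ hb => rw [hb] at hc; cases hc
    | step h₁ _ _ hc' _ =>
      rw [hc] at hc'
      cases hc'
      obtain ⟨rfl, rfl⟩ := ih h₁
      exact ⟨rfl, rfl⟩

theorem Reach.congr {b m : ℕ} {A : Finset ℕ} (hP : ∀ j ∈ T, P j = P' j)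
    (h : Reach P T NF k b A m) : Reach P' T NF k b A m := by
  have hk : ∀ p, kids P T p = kids P' T p := fun p =>
    Finset.filter_congr fun c hc => by rw [hP c hc]
  induction h with
  | root hb h0 => exact .root hb (hP _ hb ▸ h0)
  | step _ hn hc hp hle ih =>
    rw [hk] at hle ⊢
    exact .step ih hn hc (hP _ hc ▸ hp) hle

theorem reach_congr {b m : ℕ} {A : Finset ℕ} (hP : ∀ j ∈ T, P j = P' j) :
    Reach P T NF k b A m ↔ Reach P' T NF k b A m :=
  ⟨.congr hP, .congr fun j hj => (hP j hj).symm⟩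

/-- In a smaller forest the sums are smaller. -/
theorem Reach.anti {b m : ℕ} {A : Finset ℕ} (hsub : T' ⊆ T) (hcl : Closed P T')
    (h : Reach P T ∅ k b A m) (hb : b ∈ T') : ∃ m' ≤ m, Reach P T' ∅ k b A m' := by
  induction h with
  | root _ h0 => exact ⟨0, le_rfl, .root hb h0⟩
  | @step p c m A _ _ _ hp hle ih =>
    obtain ⟨m', hm', h'⟩ := ih (hcl _ hb _ hp)
    have h1 : (kids P T' p).card ≤ (kids P T p).card := Finset.card_le_card (kids_mono hsub p)
    exact ⟨m' + (kids P T' p).card - 1, by omega, .step h' (by simp) hb hp (by omega)⟩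

/-- `W` and `NF` collect the cores and the heavy nodes of the parts `U i` of `T`. -/
structure IsMerge {ι : Type*} (P : ℕ → Option ℕ) (U : ι → Finset ℕ) (T W : Finset ℕ) (NF : Set ℕ)
    (k : ℕ) : Prop where
  closed : ∀ i, Closed P (U i)
  mem_union : ∀ b, b ∈ T ↔ ∃ i, b ∈ U i
  mem_cores : ∀ b, b ∈ W ↔ ∃ i, InCore P (U i) k b
  mem_heavy : ∀ b, b ∈ NF ↔ ∃ i, Heavy P (U i) k b

namespace IsMerge

variable {ι : Type*} {U : ι → Finset ℕ} {W : Finset ℕ} {b m : ℕ} {A : Finset ℕ}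

theorem subset_union (h : IsMerge P U T W NF k) (i : ι) : U i ⊆ T :=
  fun b hb => (h.mem_union b).2 ⟨i, hb⟩

theorem cores_subset (h : IsMerge P U T W NF k) : W ⊆ T := fun b hb => by
  obtain ⟨i, A, m, hr⟩ := (h.mem_cores b).1 hb
  exact h.subset_union i hr.mem

/-- Sums only decrease on passing to a part, so a core node of the union is in the core of every
part that contains it. -/
theorem mem_cores_of_reach (h : IsMerge P U T W NF k) (hr : Reach P T ∅ k b A m) : b ∈ W := by
  obtain ⟨i, hi⟩ := (h.mem_union b).1 hr.mem
  obtain ⟨m', -, h'⟩ := hr.anti (h.subset_union i) (h.closed i) hi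
  exact (h.mem_cores b).2 ⟨i, A, m', h'⟩

/-- A child of b that lies in the part U i can be missing from the core of U i only if b is heavy
there. If b carries no such mark, all its children are visible. -/
theorem kids_eq (h : IsMerge P U T W NF k) (hr : Reach P T ∅ k b A m) (hb : b ∉ NF) :
    kids P W b = kids P T b := by
  refine (kids_mono h.cores_subset b).antisymm fun c hc => ?_
  obtain ⟨hcT, hcp⟩ := Finset.mem_filter.1 hc
  refine Finset.mem_filter.2 ⟨?_, hcp⟩
  obtain ⟨i, hi⟩ := (h.mem_union c).1 hcT
  obtain ⟨m', -, h'⟩ := hr.anti (h.subset_union i) (h.closed i) (h.closed i c hi b hcp)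
  have : m' + (kids P (U i) b).card ≤ k + 1 := by
    by_contra! hlt
    exact hb ((h.mem_heavy b).2 ⟨i, A, m', h', hlt⟩)
  exact (h.mem_cores c).2 ⟨i, _, _, .step h' (by simp) hi hcp this⟩

/-- Both the sum and the number of children grow from a part to the union, so a node that is heavy
in a part is heavy in the union as soon as it is in the core there. -/
theorem lt_of_mem_heavy (h : IsMerge P U T W NF k) (hr : Reach P T ∅ k b A m) (hb : b ∈ NF) :
    k + 1 < m + (kids P T b).card := by
  obtain ⟨i, A', m', h', hlt⟩ := (h.mem_heavy b).1 hb
  obtain ⟨m'', hle'', h''⟩ := hr.anti (h.subset_union i) (h.closed i) h'.mem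
  have := (h'.unique h'').2
  have h1 := Finset.card_le_card (kids_mono (P := P) (h.subset_union i) b)
  omega

/-- The core of a union can be computed from the cores and the heavy nodes of the parts. -/
theorem reach_iff (h : IsMerge P U T W NF k) : Reach P W NF k b A m ↔ Reach P T ∅ k b A m := by
  constructor
  · intro hr
    induction hr with
    | root hb h0 => exact .root (h.cores_subset hb) h0
    | step _ hn hc hp hle ih =>
      rw [h.kids_eq ih hn] at hle ⊢
      exact .step ih (by simp) (h.cores_subset hc) hp hle
  · intro hr
    induction hr with
    | root hb h0 => exact .root (h.mem_cores_of_reach (.root hb h0)) h0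
    | @step p c m A hpr hn hc hp hle ih =>
      have hnf : p ∉ NF := fun hmem => by
        have := h.lt_of_mem_heavy hpr hmem
        omega
      have hcW := h.mem_cores_of_reach (.step hpr hn hc hp hle)
      rw [← h.kids_eq hpr hnf] at hle ⊢
      exact .step ih hnf hcW hp hle

/-- Lets a node compute the marks it has to pass on, although it sees only the cores. -/
theorem heavy_iff (h : IsMerge P U T W NF k) (hr : Reach P T ∅ k b A m) :
    k + 1 < m + (kids P T b).card ↔ b ∈ NF ∨ k + 1 < m + (kids P W b).card := by
  by_cases hb : b ∈ NF
  · simp [hb, h.lt_of_mem_heavy hr hb]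
  · simp [hb, h.kids_eq hr hb]

theorem branch_iff (h : IsMerge P U T W NF k) (hr : Reach P T ∅ k b A m) :
    2 ≤ (kids P T b).card ↔ b ∈ NF ∨ 2 ≤ (kids P W b).card := by
  by_cases hb : b ∈ NF
  · have := h.lt_of_mem_heavy hr hb
    have := hr.le
    simp only [hb, true_or, iff_true]
    omega
  · simp [hb, h.kids_eq hr hb]

end IsMerge

/-! ### The size of a core. -/

open Classical in
/-- The core as a finite set. -/
noncomputable def core (P : ℕ → Option ℕ) (T : Finset ℕ) (k : ℕ) : Finset ℕ :=
  T.filter (InCore P T k)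

theorem mem_core {b : ℕ} : b ∈ core P T k ↔ InCore P T k b := by
  simp only [core, Finset.mem_filter, and_iff_right_iff_imp]
  rintro ⟨A, m, h⟩
  exact h.mem

/-- A node with remaining budget a and s children leaves each child the budget a - (s - 1). As s ≤
2^(s - 1), the total weight 2^budget does not increase from the node to its children. -/
theorem mul_two_pow_le {s a : ℕ} (h1 : 1 ≤ s) (h2 : s ≤ a + 1) :
    s * 2 ^ (a - (s - 1)) ≤ 2 ^ a := by
  have h3 : s ≤ 2 ^ (s - 1) := by
    have := Nat.lt_two_pow_self (n := s - 1)
    omega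
  calc s * 2 ^ (a - (s - 1)) ≤ 2 ^ (s - 1) * 2 ^ (a - (s - 1)) := Nat.mul_le_mul_right _ h3
    _ = 2 ^ a := by rw [← pow_add]; congr 1; omega

/-- The core has at most `2 ^ k` nodes on each level. -/
theorem card_core_le {lvl : ℕ → ℕ} {H : ℕ}
    (hroot : ∀ b ∈ T, ∀ b' ∈ T, P b = none → P b' = none → b = b')
    (hlvl_root : ∀ b ∈ T, P b = none → lvl b = 0)
    (hlvl : ∀ c ∈ T, ∀ p, P c = some p → lvl c = lvl p + 1) (hH : ∀ b ∈ T, lvl b ≤ H) :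
    (core P T k).card ≤ (H + 1) * 2 ^ k := by
  classical
  have hex : ∀ b, ∃ m, b ∈ core P T k → ∃ A, Reach P T ∅ k b A m := by
    intro b
    by_cases hb : b ∈ core P T k
    · obtain ⟨A, m, h⟩ := mem_core.1 hb
      exact ⟨m, fun _ => ⟨A, h⟩⟩
    · exact ⟨0, fun h => absurd h hb⟩
  choose μ hμ using hex
  -- Potential argument: a core node with sum μ has weight 2^(k - μ), and the weight of a level is
  -- bounded by that of the previous level, starting with the root alone.
  have hlev : ∀ l, ∑ b ∈ (core P T k).filter (lvl · = l), 2 ^ (k - μ b) ≤ 2 ^ k := by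
    intro l
    induction l with
    | zero =>
      have hcard : ((core P T k).filter (lvl · = 0)).card ≤ 1 := by
        refine Finset.card_le_one.2 fun b hb b' hb' => ?_
        rw [Finset.mem_filter] at hb hb'
        have key : ∀ x, x ∈ core P T k ∧ lvl x = 0 → x ∈ T ∧ P x = none := by
          rintro x ⟨hx, h0⟩
          obtain ⟨A, hA⟩ := hμ x hx
          refine ⟨hA.mem, ?_⟩
          cases hp : P x with
          | none => rfl
          | some p =>
            have := hlvl x hA.mem p hp
            omega
        exact hroot b (key b hb).1 b' (key b' hb').1 (key b hb).2 (key b' hb').2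
      calc _ ≤ ((core P T k).filter (lvl · = 0)).card • 2 ^ k :=
            Finset.sum_le_card_nsmul _ _ _ fun b _ => Nat.pow_le_pow_right (by omega) (by omega)
        _ ≤ 1 • 2 ^ k := Nat.mul_le_mul_right _ hcard
        _ = 2 ^ k := by simp
    | succ l ih =>
      have key : ∀ c ∈ (core P T k).filter (lvl · = l + 1), ∃ p, P c = some p ∧
          p ∈ (core P T k).filter (lvl · = l) ∧ μ p + (kids P T p).card ≤ k + 1 ∧
          μ c = μ p + (kids P T p).card - 1 := by
        intro c hc
        rw [Finset.mem_filter] at hc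
        obtain ⟨A, hA⟩ := hμ c hc.1
        generalize hmc : μ c = mc at hA
        cases hA with
        | root hb h0 =>
          have := hlvl_root c hb h0
          omega
        | @step p _ m A hpr hn hcT hp hle =>
          have hpc : p ∈ core P T k := mem_core.2 ⟨_, _, hpr⟩
          obtain ⟨B, hB⟩ := hμ p hpc
          have hm := (hB.unique hpr).2
          have := hlvl c hcT p hp
          exact ⟨p, hp, Finset.mem_filter.2 ⟨hpc, by omega⟩, by omega, by omega⟩
      have hmaps : ∀ c ∈ (core P T k).filter (lvl · = l + 1),
          (P c).getD 0 ∈ (core P T k).filter (lvl · = l) := by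
        intro c hc
        obtain ⟨p, hp, hmem, -⟩ := key c hc
        rwa [hp]
      rw [← Finset.sum_fiberwise_of_maps_to hmaps]
      refine (Finset.sum_le_sum fun p _ => ?_).trans ih
      set F := ((core P T k).filter (lvl · = l + 1)).filter fun c => (P c).getD 0 = p with hF
      rcases F.eq_empty_or_nonempty with h0 | ⟨c₀, hc₀⟩
      · rw [h0]; simp
      · have hval : ∀ c ∈ F, P c = some p ∧ c ∈ T ∧ μ p + (kids P T p).card ≤ k + 1 ∧
            μ c = μ p + (kids P T p).card - 1 := by
          intro c hc
          rw [hF, Finset.mem_filter] at hc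
          obtain ⟨p', hp', -, h1, h2⟩ := key c hc.1
          rw [hp'] at hc
          obtain rfl : p' = p := hc.2
          obtain ⟨A, hA⟩ := hμ c (Finset.mem_filter.1 hc.1).1
          exact ⟨hp', hA.mem, h1, h2⟩
        have hsubF : F ⊆ kids P T p := fun c hc =>
          Finset.mem_filter.2 ⟨(hval c hc).2.1, (hval c hc).1⟩
        have h1 := one_le_card_kids (hval c₀ hc₀).2.1 (hval c₀ hc₀).1
        have h2 := (hval c₀ hc₀).2.2.1
        calc ∑ c ∈ F, 2 ^ (k - μ c)
            = ∑ c ∈ F, 2 ^ (k - μ p - ((kids P T p).card - 1)) := by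
              refine Finset.sum_congr rfl fun c hc => ?_
              rw [(hval c hc).2.2.2]
              congr 1
              omega
          _ = F.card * 2 ^ (k - μ p - ((kids P T p).card - 1)) := by
              rw [Finset.sum_const, smul_eq_mul]
          _ ≤ (kids P T p).card * 2 ^ (k - μ p - ((kids P T p).card - 1)) :=
              Nat.mul_le_mul_right _ (Finset.card_le_card hsubF)
          _ ≤ 2 ^ (k - μ p) := mul_two_pow_le h1 (by omega)
  have hmaps : ∀ b ∈ core P T k, lvl b ∈ Finset.range (H + 1) := by
    intro b hb
    obtain ⟨A, hA⟩ := hμ b hb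
    have := hH b hA.mem
    rw [Finset.mem_range]
    omega
  rw [Finset.card_eq_sum_card_fiberwise hmaps]
  calc _ ≤ ∑ _l ∈ Finset.range (H + 1), 2 ^ k := by
        -- Each weight is at least 1, so the weight of a level bounds its number of core nodes.
        refine Finset.sum_le_sum fun l _ => le_trans ?_ (hlev l)
        rw [Finset.card_eq_sum_ones]
        exact Finset.sum_le_sum fun b _ => Nat.one_le_two_pow
    _ = (H + 1) * 2 ^ k := by simp

end Forest

/-! ### Counting edges between subtrees -/

namespace RootedTree

open Classical in
-- An edge of δ(A) has exactly one orientation that starts in A, so cut edges become ordered pairs,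
-- which are easier to split and to add up.
theorem gam_eq_card {V : Type*} [Fintype V] (G : SimpleGraph V) (A B : Set V) :
    gam G A B = (Finset.univ.filter fun p : V × V =>
      G.Adj p.1 p.2 ∧ p.1 ∈ A ∧ p.2 ∉ A ∧ ¬ (p.1 ∈ B ↔ p.2 ∈ B)).card := by
  have himg : cutEdges G A ∩ cutEdges G B = (fun p : V × V => s(p.1, p.2)) ''
      ((Finset.univ.filter fun p : V × V =>
        G.Adj p.1 p.2 ∧ p.1 ∈ A ∧ p.2 ∉ A ∧ ¬ (p.1 ∈ B ↔ p.2 ∈ B) : Finset (V × V)) :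
        Set (V × V)) := by
    ext e
    simp only [cutEdges, Set.mem_inter_iff, Set.mem_ofPred_eq, Set.mem_image, Finset.coe_filter,
      Finset.mem_univ, true_and, Prod.exists]
    constructor
    · rintro ⟨⟨he, x, hx, y, hy, rfl⟩, -, x', hx', y', hy', h⟩
      refine ⟨x, y, ⟨he, hx, hy, ?_⟩, rfl⟩
      rw [Sym2.eq_iff] at h
      rcases h with ⟨rfl, rfl⟩ | ⟨rfl, rfl⟩ <;> tauto
    · rintro ⟨x, y, ⟨he, hx, hy, hxy⟩, rfl⟩
      refine ⟨⟨he, x, hx, y, hy, rfl⟩, he, ?_⟩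
      by_cases hxB : x ∈ B
      · exact ⟨x, hxB, y, by tauto, rfl⟩
      · exact ⟨y, by tauto, x, hxB, Sym2.eq_swap⟩
  rw [gam, himg, Set.InjOn.ncard_image, Set.ncard_coe_finset]
  rintro ⟨x, y⟩ hp ⟨x', y'⟩ hp' h
  simp only [Finset.coe_filter, Finset.mem_univ, true_and, Set.mem_ofPred_eq] at hp hp'
  rw [Sym2.eq_iff] at h
  rcases h with ⟨h1, h2⟩ | ⟨h1, h2⟩
  · exact Prod.ext h1 h2
  · exact absurd ((show x = y' from h1) ▸ hp.2.1) hp'.2.2.1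

end RootedTree

namespace Network

open RootedTree Classical

variable (N : Network)

/-- Adjacency by an edge that is not in the tree. -/
def NTAdj (x y : N.V) : Prop := N.G.Adj x y ∧ ¬ N.T.Adj x y

/-- The number of non-tree edges with first end below `v`, counted for each such end. -/
noncomputable def vol (v : N.V) : ℕ :=
  (Finset.univ.filter fun p : N.V × N.V => N.NTAdj p.1 p.2 ∧ v ∈ ancestors N.T N.r p.1).card

/-- The number of non-tree edges from below `v` to below `u`. -/
noncomputable def cnt (v u : N.V) : ℕ :=
  (Finset.univ.filter fun p : N.V × N.V => (N.NTAdj p.1 p.2 ∧ v ∈ ancestors N.T N.r p.1) ∧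
    u ∈ ancestors N.T N.r p.2).card

/-- The children of `v` in the tree. -/
noncomputable def children (v : N.V) : Finset N.V :=
  Finset.univ.filter fun c => parent N.T N.r c = some v

/-- The neighbours of `v` by edges that are not in the tree. -/
noncomputable def ntNbrs (v : N.V) : Finset N.V := Finset.univ.filter (N.NTAdj v)

variable {N}

theorem NTAdj.symm {x y : N.V} (h : N.NTAdj x y) : N.NTAdj y x :=
  ⟨h.1.symm, fun h' => h.2 h'.symm⟩

theorem mem_children {v c : N.V} : c ∈ N.children v ↔ parent N.T N.r c = some v := by
  simp [children]

theorem mem_ntNbrs {v y : N.V} : y ∈ N.ntNbrs v ↔ N.NTAdj v y := by simp [ntNbrs]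

/-- The nodes below `v` are `v` and the nodes below its children. -/
theorem sum_desc (f : N.V → ℕ) (v : N.V) :
    ∑ x ∈ Finset.univ.filter (fun x => v ∈ ancestors N.T N.r x), f x =
      f v + ∑ c ∈ N.children v,
        ∑ x ∈ Finset.univ.filter (fun x => c ∈ ancestors N.T N.r x), f x := by
  have hset : Finset.univ.filter (fun x => v ∈ ancestors N.T N.r x) =
      insert v ((N.children v).biUnion fun c =>
        Finset.univ.filter (fun x => c ∈ ancestors N.T N.r x)) := by
    ext x
    simp only [Finset.mem_filter, Finset.mem_univ, true_and, Finset.mem_insert,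
      Finset.mem_biUnion, mem_children]
    constructor
    · induction x using induction_parent (r := N.r) N.bfs.isTree with
      | root =>
        rw [ancestors_root isTree]
        exact fun h => .inl h.symm
      | step x p hp ih =>
        intro h
        rw [ancestors_of_parent isTree hp] at h
        rcases h with h | h
        · exact .inl h.symm
        · right
          rcases ih h with rfl | ⟨c, hc, hcp⟩
          · exact ⟨x, hp, self_mem_ancestors isTree x⟩
          · exact ⟨c, hc, by rw [ancestors_of_parent isTree hp]; exact .inr hcp⟩
    · rintro (rfl | ⟨c, hc, hx⟩)
      · exact self_mem_ancestors isTree _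
      · exact parent_mem_ancestors isTree hx hc
  rw [hset, Finset.sum_insert, Finset.sum_biUnion]
  · intro c hc c' hc' hne
    refine Finset.disjoint_left.2 fun x hx hx' => hne ?_
    simp only [Finset.mem_filter, Finset.mem_univ, true_and] at hx hx'
    have h1 := level_of_parent isTree (mem_children.1 hc)
    have h2 := level_of_parent isTree (mem_children.1 hc')
    rcases ancestors_total isTree hx hx' with h | h
    · exact eq_of_mem_ancestors_of_level isTree h (by omega)
    · exact (eq_of_mem_ancestors_of_level isTree h (by omega)).symm
  · simp only [Finset.mem_biUnion, mem_children, Finset.mem_filter, Finset.mem_univ, true_and,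
      not_exists, not_and]
    intro c hc hmem
    have h1 := level_of_parent isTree hc
    have h2 := level_le_of_mem_ancestors isTree hmem
    omega

theorem card_filter_prod {α : Type*} [Fintype α] (P : α → Prop) (Q : α → α → Prop)
    [DecidablePred P] [∀ x, DecidablePred (Q x)]
    [DecidablePred fun p : α × α => Q p.1 p.2 ∧ P p.1] :
    (Finset.univ.filter fun p : α × α => Q p.1 p.2 ∧ P p.1).card =
      ∑ x ∈ Finset.univ.filter P, (Finset.univ.filter (Q x)).card := by
  simp only [Finset.card_filter, Fintype.sum_prod_type, Finset.sum_filter]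
  refine Finset.sum_congr rfl fun x _ => ?_
  by_cases h : P x <;> simp [h]

/-- Pairs are sorted by their first end, and the nodes below v are v itself and the disjoint sets
below its children. This recursion, like `cnt_eq`, is what is evaluated from the leaves to the root.
-/
theorem vol_eq (v : N.V) : N.vol v = (N.ntNbrs v).card + ∑ c ∈ N.children v, N.vol c := by
  have h : ∀ v, N.vol v = ∑ x ∈ Finset.univ.filter (fun x => v ∈ ancestors N.T N.r x),
      (N.ntNbrs x).card := fun v => by
    unfold vol ntNbrs
    exact card_filter_prod (fun x => v ∈ ancestors N.T N.r x) N.NTAdj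
  rw [h, sum_desc]
  simp only [h]

theorem cnt_eq (v u : N.V) : N.cnt v u =
    ((N.ntNbrs v).filter fun y => u ∈ ancestors N.T N.r y).card +
      ∑ c ∈ N.children v, N.cnt c u := by
  have h : ∀ v, N.cnt v u = ∑ x ∈ Finset.univ.filter (fun x => v ∈ ancestors N.T N.r x),
      ((N.ntNbrs x).filter fun y => u ∈ ancestors N.T N.r y).card := by
    intro v
    simp only [ntNbrs, Finset.filter_filter]
    rw [← card_filter_prod (fun x => v ∈ ancestors N.T N.r x)
      (fun x y => N.NTAdj x y ∧ u ∈ ancestors N.T N.r y), cnt]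
    congr 1
    exact Finset.filter_congr fun p _ => by tauto
  rw [h, sum_desc]
  simp only [h]

theorem cnt_pos_iff {v u : N.V} : 0 < N.cnt v u ↔
    ∃ x y, N.NTAdj x y ∧ v ∈ ancestors N.T N.r x ∧ u ∈ ancestors N.T N.r y := by
  simp [cnt, Finset.card_pos, Finset.Nonempty, and_assoc]

theorem cnt_comm (u v : N.V) : N.cnt u v = N.cnt v u := by
  refine Finset.card_bij' (fun p _ => p.swap) (fun p _ => p.swap) ?_ ?_ ?_ ?_
  · simp only [Finset.mem_filter, Finset.mem_univ, true_and]
    exact fun p h => ⟨⟨h.1.1.symm, h.2⟩, h.1.2⟩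
  · simp only [Finset.mem_filter, Finset.mem_univ, true_and]
    exact fun p h => ⟨⟨h.1.1.symm, h.2⟩, h.1.2⟩
  · simp
  · simp

theorem cnt_add_card (v u : N.V) : N.cnt v u +
    (Finset.univ.filter fun p : N.V × N.V => (N.NTAdj p.1 p.2 ∧ v ∈ ancestors N.T N.r p.1) ∧
      u ∉ ancestors N.T N.r p.2).card = N.vol v := by
  unfold cnt vol
  rw [← Finset.card_filter_add_card_filter_not (s := Finset.univ.filter fun p : N.V × N.V =>
    N.NTAdj p.1 p.2 ∧ v ∈ ancestors N.T N.r p.1) (fun p => u ∈ ancestors N.T N.r p.2),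
    Finset.filter_filter, Finset.filter_filter]

/-- Tree edges contribute to `γ(v↓, u↓)` only if `u = v`. -/
theorem card_tree_cut (v u : N.V) :
    (Finset.univ.filter fun p : N.V × N.V => N.T.Adj p.1 p.2 ∧ p.1 ∈ desc N.T N.r v ∧
      p.2 ∉ desc N.T N.r v ∧ ¬ (p.1 ∈ desc N.T N.r u ↔ p.2 ∈ desc N.T N.r u)).card =
      if u = v ∧ parent N.T N.r v ≠ none then 1 else 0 := by
  have key : ∀ w x y, N.T.Adj x y → w ∈ ancestors N.T N.r x → w ∉ ancestors N.T N.r y →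
      x = w ∧ parent N.T N.r w = some y := by
    intro w x y h hx hy
    rcases (tree_adj_iff (r := N.r) isTree).1 h with h | h
    · rw [ancestors_of_parent isTree h] at hy
      exact absurd (.inr hx) hy
    · rw [ancestors_of_parent isTree h] at hx
      rcases hx with rfl | hx
      · exact ⟨rfl, h⟩
      · exact absurd hx hy
  split_ifs with h
  · obtain ⟨rfl, hp⟩ := h
    obtain ⟨p, hp⟩ := Option.ne_none_iff_exists'.1 hp
    rw [Finset.card_eq_one]
    refine ⟨(u, p), ?_⟩
    ext ⟨x, y⟩
    simp only [Finset.mem_filter, Finset.mem_univ, true_and, Finset.mem_singleton, Prod.mk.injEq]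
    constructor
    · rintro ⟨h1, h2, h3, -⟩
      obtain ⟨rfl, h5⟩ := key u x y h1 h2 h3
      rw [hp] at h5
      exact ⟨rfl, (Option.some.inj h5).symm⟩
    · rintro ⟨rfl, rfl⟩
      have h1 : x ∈ desc N.T N.r x := self_mem_ancestors isTree x
      have h2 : y ∉ desc N.T N.r x := fun hmem => by
        have := level_le_of_mem_ancestors isTree (show x ∈ ancestors N.T N.r y from hmem)
        have := level_of_parent isTree hp
        omega
      exact ⟨((parent_eq_some_iff isTree).1 hp).1.symm, h1, h2, by tauto⟩
  · rw [Finset.card_eq_zero]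
    refine Finset.filter_eq_empty_iff.2 ?_
    rintro ⟨x, y⟩ - ⟨h1, h2, h3, h4⟩
    obtain ⟨rfl, hv⟩ := key v x y h1 h2 h3
    refine h ⟨?_, by simp [hv]⟩
    by_cases hx : x ∈ desc N.T N.r u
    · exact (key u x y h1 hx fun hy => h4 ⟨fun _ => hy, fun _ => hx⟩).1.symm
    · have hy : y ∈ desc N.T N.r u := by tauto
      exact absurd (show u ∈ ancestors N.T N.r x by
        rw [ancestors_of_parent isTree hv]; exact .inr hy) hx

/-- The number `γ(v↓, u↓)` in terms of numbers of non-tree edges. -/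
theorem gam_desc (v u : N.V) : gam N.G (desc N.T N.r v) (desc N.T N.r u) =
    if u ∈ ancestors N.T N.r v then
      N.vol v - N.cnt v u + if u = v ∧ parent N.T N.r v ≠ none then 1 else 0
    else if v ∈ ancestors N.T N.r u then N.vol u - N.cnt v u else N.cnt v u := by
  rw [gam_eq_card]
  -- The tree edges are split off; `card_tree_cut` shows that only the edge from v to its parent can
  -- count. In the three cases that follow, the subtree of v lies in that of u, contains it, or is
  -- disjoint from it.
  have hsplit := Finset.card_filter_add_card_filter_not (s := Finset.univ.filter
    fun p : N.V × N.V => N.G.Adj p.1 p.2 ∧ p.1 ∈ desc N.T N.r v ∧ p.2 ∉ desc N.T N.r v ∧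
      ¬ (p.1 ∈ desc N.T N.r u ↔ p.2 ∈ desc N.T N.r u)) (fun p => N.T.Adj p.1 p.2)
  rw [Finset.filter_filter, Finset.filter_filter] at hsplit
  have htree : (Finset.univ.filter fun p : N.V × N.V => (N.G.Adj p.1 p.2 ∧
      p.1 ∈ desc N.T N.r v ∧ p.2 ∉ desc N.T N.r v ∧
      ¬ (p.1 ∈ desc N.T N.r u ↔ p.2 ∈ desc N.T N.r u)) ∧ N.T.Adj p.1 p.2).card =
      if u = v ∧ parent N.T N.r v ≠ none then 1 else 0 := by
    rw [← card_tree_cut]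
    congr 1
    refine Finset.filter_congr fun p _ => ⟨fun h => ⟨h.2, h.1.2⟩, fun h => ⟨⟨N.bfs.le h.1, h.2⟩, h.1⟩⟩
  rw [htree] at hsplit
  rw [← hsplit]
  have hv := cnt_add_card v u
  have hu := cnt_add_card u v
  rw [cnt_comm] at hu
  by_cases h1 : u ∈ ancestors N.T N.r v
  · rw [if_pos h1, add_comm]
    congr 1
    rw [← hv, Nat.add_sub_cancel_left]
    congr 1
    refine Finset.filter_congr fun p _ => ?_
    have h3 : v ∈ ancestors N.T N.r p.1 → u ∈ ancestors N.T N.r p.1 := ancestors_trans isTree h1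
    have h4 : v ∈ ancestors N.T N.r p.2 → u ∈ ancestors N.T N.r p.2 := ancestors_trans isTree h1
    simp only [desc, NTAdj, Set.mem_ofPred_eq]
    tauto
  have hne : ¬ (u = v ∧ parent N.T N.r v ≠ none) :=
    fun h => h1 (h.1 ▸ self_mem_ancestors isTree _)
  rw [if_neg h1, if_neg hne, zero_add]
  by_cases h2 : v ∈ ancestors N.T N.r u
  · rw [if_pos h2, ← hu, Nat.add_sub_cancel_left]
    congr 1
    refine Finset.filter_congr fun p _ => ?_
    have h5 : u ∈ ancestors N.T N.r p.1 → v ∈ ancestors N.T N.r p.1 := ancestors_trans isTree h2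
    have h6 : u ∈ ancestors N.T N.r p.2 → v ∈ ancestors N.T N.r p.2 := ancestors_trans isTree h2
    simp only [desc, NTAdj, Set.mem_ofPred_eq]
    tauto
  · rw [if_neg h2, cnt]
    congr 1
    refine Finset.filter_congr fun p _ => ?_
    have h5 : ∀ x, ¬ (u ∈ ancestors N.T N.r x ∧ v ∈ ancestors N.T N.r x) := by
      rintro x ⟨hux, hvx⟩
      rcases ancestors_total isTree hux hvx with h | h
      · exact h1 h
      · exact h2 h
    have h6 := h5 p.1
    have h7 := h5 p.2
    simp only [desc, NTAdj, Set.mem_ofPred_eq]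
    tauto

theorem eta_eq (u : N.V) : eta N.G N.T N.r u =
    N.vol u - N.cnt u u + if parent N.T N.r u ≠ none then 1 else 0 := by
  have h : eta N.G N.T N.r u = gam N.G (desc N.T N.r u) (desc N.T N.r u) := by
    rw [eta, gam, Set.inter_self]
  rw [h, gam_desc, if_pos (self_mem_ancestors isTree u)]
  simp

theorem mem_canonicalTree_iff {v u : N.V} : u ∈ (canonicalTree N.G N.T N.r v).verts ↔
    u ∈ ancestors N.T N.r v ∨ 0 < N.cnt v u := by
  rw [mem_canonicalTree_verts, cnt_pos_iff]
  simp only [desc, NTAdj, Set.mem_ofPred_eq]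
  refine or_congr_right ⟨?_, ?_⟩
  · rintro ⟨x, hx, y, h1, h2, hu⟩
    exact ⟨x, y, ⟨h1, h2⟩, hx, hu⟩
  · rintro ⟨x, y, ⟨h1, h2⟩, hx, hu⟩
    exact ⟨x, hx, y, h1, h2, hu⟩

theorem vol_le (v : N.V) : N.vol v ≤ Fintype.card N.V ^ 2 := by
  refine (Finset.card_le_univ _).trans ?_
  simp [sq]

theorem cnt_le (v u : N.V) : N.cnt v u ≤ Fintype.card N.V ^ 2 := by
  refine (Finset.card_le_univ _).trans ?_
  simp [sq]

end Network

/-! ### Canonical trees in terms of identifiers -/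

namespace Network

open RootedTree Classical Forest

variable (N : Network)

/-- The value of `f` at the node with identifier `j`, or `d` if there is none. -/
noncomputable def atIdent {α : Type*} (f : N.V → α) (d : α) (j : ℕ) : α :=
  if h : ∃ u, N.ident u = j then f h.choose else d

/-- The identifier of the parent of the node with a given identifier. -/
noncomputable def par : ℕ → Option ℕ := N.atIdent (fun u => (parent N.T N.r u).map N.ident) none

/-- The identifiers of the ancestors of `v`. -/
noncomputable def anc (v : N.V) : Finset ℕ := (N.input v).ancestors

/-- The identifiers of the ancestors of the ends of the non-tree edges that start below `v`. -/
noncomputable def supp (v : N.V) : Finset ℕ := (Finset.univ.filter (0 < N.cnt v ·)).image N.ident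

/-- The identifiers of the nodes of the canonical tree of `v`. -/
noncomputable def canon (v : N.V) : Finset ℕ := N.supp v ∪ N.anc v

variable {N}

theorem atIdent_ident {α : Type*} (f : N.V → α) (d : α) (u : N.V) :
    N.atIdent f d (N.ident u) = f u := by
  have hex : ∃ u', N.ident u' = N.ident u := ⟨u, rfl⟩
  rw [atIdent, dif_pos hex, N.inj hex.choose_spec]

theorem par_ident (u : N.V) : N.par (N.ident u) = (parent N.T N.r u).map N.ident :=
  atIdent_ident _ _ u

theorem par_ident_eq_none_iff {u : N.V} : N.par (N.ident u) = none ↔ u = N.r := by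
  rw [par_ident, Option.map_eq_none_iff, parent_eq_none_iff isTree]

theorem par_ident_eq_some_iff {u p : N.V} :
    N.par (N.ident u) = some (N.ident p) ↔ parent N.T N.r u = some p := by
  rw [par_ident, Option.map_eq_some_iff]
  constructor
  · rintro ⟨q, hq, h⟩
    rwa [← N.inj h]
  · exact fun h => ⟨p, h, rfl⟩

theorem exists_of_par_ident {u : N.V} {j : ℕ} (h : N.par (N.ident u) = some j) :
    ∃ p, parent N.T N.r u = some p ∧ N.ident p = j := by
  rwa [par_ident, Option.map_eq_some_iff] at h

theorem mem_anc {v : N.V} {j : ℕ} : j ∈ N.anc v ↔ ∃ u ∈ ancestors N.T N.r v, N.ident u = j := by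
  simp [anc, input, localInput]

theorem ident_mem_anc {u v : N.V} : N.ident u ∈ N.anc v ↔ u ∈ ancestors N.T N.r v := by
  rw [mem_anc]
  exact ⟨fun ⟨w, hw, h⟩ => N.inj h ▸ hw, fun h => ⟨u, h, rfl⟩⟩

theorem mem_supp {v : N.V} {j : ℕ} : j ∈ N.supp v ↔ ∃ u, 0 < N.cnt v u ∧ N.ident u = j := by
  simp [supp]

theorem ident_mem_supp {u v : N.V} : N.ident u ∈ N.supp v ↔ 0 < N.cnt v u := by
  rw [mem_supp]
  exact ⟨fun ⟨w, hw, h⟩ => N.inj h ▸ hw, fun h => ⟨u, h, rfl⟩⟩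

theorem ident_mem_canon {u v : N.V} :
    N.ident u ∈ N.canon v ↔ u ∈ (canonicalTree N.G N.T N.r v).verts := by
  rw [canon, Finset.mem_union, ident_mem_supp, ident_mem_anc, mem_canonicalTree_iff, or_comm]

theorem exists_of_mem_anc {v : N.V} {j : ℕ} (h : j ∈ N.anc v) : ∃ u, N.ident u = j :=
  (mem_anc.1 h).imp fun _ h => h.2

theorem exists_of_mem_supp {v : N.V} {j : ℕ} (h : j ∈ N.supp v) : ∃ u, N.ident u = j :=
  (mem_supp.1 h).imp fun _ h => h.2

theorem exists_of_mem_canon {v : N.V} {j : ℕ} (h : j ∈ N.canon v) : ∃ u, N.ident u = j :=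
  (Finset.mem_union.1 h).elim exists_of_mem_supp exists_of_mem_anc

theorem closed_anc (v : N.V) : Closed N.par (N.anc v) := by
  intro c hc j hj
  obtain ⟨u, hu, rfl⟩ := mem_anc.1 hc
  obtain ⟨p, hp, rfl⟩ := exists_of_par_ident hj
  exact ident_mem_anc.2 (parent_mem_ancestors isTree hu hp)

theorem closed_supp (v : N.V) : Closed N.par (N.supp v) := by
  intro c hc j hj
  obtain ⟨u, hu, rfl⟩ := mem_supp.1 hc
  obtain ⟨p, hp, rfl⟩ := exists_of_par_ident hj
  rw [cnt_pos_iff] at hu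
  obtain ⟨x, y, hxy, hx, hy⟩ := hu
  rw [ident_mem_supp, cnt_pos_iff]
  exact ⟨x, y, hxy, hx, parent_mem_ancestors isTree hy hp⟩

theorem card_kids_anc_le (v : N.V) (j : ℕ) : (kids N.par (N.anc v) j).card ≤ 1 := by
  refine Finset.card_le_one.2 fun c hc c' hc' => ?_
  simp only [kids, Finset.mem_filter] at hc hc'
  obtain ⟨u, hu, rfl⟩ := mem_anc.1 hc.1
  obtain ⟨u', hu', rfl⟩ := mem_anc.1 hc'.1
  obtain ⟨p, hp, rfl⟩ := exists_of_par_ident hc.2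
  have h1 := level_of_parent isTree hp
  have h2 := level_of_parent isTree (par_ident_eq_some_iff.1 hc'.2)
  rcases ancestors_total isTree hu hu' with h | h
  · rw [eq_of_mem_ancestors_of_level isTree h (by omega)]
  · rw [eq_of_mem_ancestors_of_level isTree h (by omega)]

/-- The ancestors form a path, so all sums are 0. Such a set is its own core for every k and has no
heavy nodes; hence ancestor sets can be merged with cores without any marks. -/
theorem reach_anc {k : ℕ} {u v : N.V} :
    u ∈ ancestors N.T N.r v → ∃ A, Reach N.par (N.anc v) ∅ k (N.ident u) A 0 := by
  induction u using induction_parent (r := N.r) N.bfs.isTree with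
  | root =>
    intro h
    exact ⟨_, .root (ident_mem_anc.2 h) (par_ident_eq_none_iff.2 rfl)⟩
  | step u p hp ih =>
    intro h
    obtain ⟨A, hA⟩ := ih (parent_mem_ancestors isTree h hp)
    have h1 := card_kids_anc_le v (N.ident p)
    have h2 := Reach.step hA (by simp) (ident_mem_anc.2 h) (par_ident_eq_some_iff.2 hp)
      (by omega)
    rw [show 0 + (kids N.par (N.anc v) (N.ident p)).card - 1 = 0 by omega] at h2
    exact ⟨_, h2⟩

theorem inCore_anc_iff {k : ℕ} {v : N.V} {j : ℕ} : InCore N.par (N.anc v) k j ↔ j ∈ N.anc v := by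
  constructor
  · rintro ⟨A, m, h⟩
    exact h.mem
  · intro h
    obtain ⟨u, hu, rfl⟩ := mem_anc.1 h
    obtain ⟨A, hA⟩ := reach_anc (k := k) hu
    exact ⟨A, 0, hA⟩

theorem not_heavy_anc {k : ℕ} {v : N.V} {j : ℕ} : ¬ Heavy N.par (N.anc v) k j := by
  rintro ⟨A, m, h, hlt⟩
  obtain ⟨u, hu, rfl⟩ := mem_anc.1 h.mem
  obtain ⟨A', hA'⟩ := reach_anc (k := k) hu
  have := (h.unique hA').2
  have := card_kids_anc_le v (N.ident u)
  omega

/-- The set collected along a derivation is the true ancestor set. A node can thus tell from the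
received parent pointers whether it is an ancestor of u, as needed for γ. -/
theorem reach_ancestors {S : Finset ℕ} {NF : Set ℕ} {k j m : ℕ} {A : Finset ℕ}
    (h : Reach N.par S NF k j A m) : ∀ b, N.ident b = j → A = N.anc b := by
  induction h with
  | root hb h0 =>
    rintro b rfl
    rw [par_ident_eq_none_iff] at h0
    subst h0
    ext i
    rw [mem_anc, ancestors_root isTree]
    simp [eq_comm]
  | @step p c m A hpr _ hc hp _ ih =>
    rintro b rfl
    obtain ⟨q, hq, rfl⟩ := exists_of_par_ident hp
    rw [ih q rfl]
    ext i
    simp only [Finset.mem_insert, mem_anc, ancestors_of_parent isTree hq, Set.mem_insert_iff,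
      exists_eq_or_imp]
    exact or_congr_left eq_comm

/-! ### Branching numbers -/

section Branching

variable {v : N.V}

theorem card_kids_canon (p : N.V) : (kids N.par (N.canon v) (N.ident p)).card =
    {c | (canonicalTree N.G N.T N.r v).Adj p c ∧ parent N.T N.r c = some p}.ncard := by
  have h : ((kids N.par (N.canon v) (N.ident p) : Finset ℕ) : Set ℕ) = N.ident ''
      {c | (canonicalTree N.G N.T N.r v).Adj p c ∧ parent N.T N.r c = some p} := by
    ext j
    simp only [kids, Finset.coe_filter, Set.mem_ofPred_eq, Set.mem_image]
    constructor
    · rintro ⟨hj, hp⟩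
      obtain ⟨c, rfl⟩ := exists_of_mem_canon hj
      rw [par_ident_eq_some_iff] at hp
      rw [ident_mem_canon] at hj
      refine ⟨c, ⟨?_, hp⟩, rfl⟩
      rw [canonicalTree_adj isTree]
      exact ⟨canonicalTree_closed isTree hj hp, hj, ((parent_eq_some_iff isTree).1 hp).1⟩
    · rintro ⟨c, ⟨hadj, hp⟩, rfl⟩
      exact ⟨ident_mem_canon.2 hadj.snd_mem, par_ident_eq_some_iff.2 hp⟩
  rw [← Set.ncard_image_of_injective _ N.inj, ← h, Set.ncard_coe_finset]

theorem isBranchNode_iff (p : N.V) : IsBranchNode N.r (canonicalTree N.G N.T N.r v) p ↔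
    2 ≤ (kids N.par (N.canon v) (N.ident p)).card := by
  rw [card_kids_canon, IsBranchNode]

/-- Degree is number of children plus one for the parent, except at the root. This exception is the
source of the offset between branching number and sum. -/
theorem ncard_neighborSet {p : N.V} (hp : p ∈ (canonicalTree N.G N.T N.r v).verts) :
    ((canonicalTree N.G N.T N.r v).neighborSet p).ncard =
      (kids N.par (N.canon v) (N.ident p)).card + if p = N.r then 0 else 1 := by
  have hset : (canonicalTree N.G N.T N.r v).neighborSet p =
      {c | (canonicalTree N.G N.T N.r v).Adj p c ∧ parent N.T N.r c = some p} ∪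
        {q | parent N.T N.r p = some q} := by
    ext c
    simp only [SimpleGraph.Subgraph.mem_neighborSet, Set.mem_union, Set.mem_ofPred_eq]
    constructor
    · intro h
      rcases (tree_adj_iff (r := N.r) isTree).1 h.adj_sub with h' | h'
      · exact .inl ⟨h, h'⟩
      · exact .inr h'
    · rintro (h | h)
      · exact h.1
      · rw [canonicalTree_adj isTree]
        exact ⟨hp, canonicalTree_closed isTree hp h, ((parent_eq_some_iff isTree).1 h).1.symm⟩
  rw [hset, Set.ncard_union_eq _ (Set.toFinite _) (Set.toFinite _), card_kids_canon]
  · congr 1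
    split_ifs with h
    · rw [h, parent_root isTree]
      simp
    · cases hq : parent N.T N.r p with
      | none => exact absurd ((parent_eq_none_iff isTree).1 hq) h
      | some q =>
        have : {q' | some q = some q'} = {q} := by
          ext q'; simp [eq_comm]
        rw [this, Set.ncard_singleton]
  · refine Set.disjoint_left.2 ?_
    rintro c ⟨-, h1⟩ h2
    have h3 := level_of_parent isTree h1
    have h4 := level_of_parent isTree (show parent N.T N.r p = some c from h2)
    omega

variable (v) in
/-- The level of the first branch node of the canonical tree. -/
noncomputable def branchLev : ℕ :=
  level N.T N.r (firstBranchNode N.r (canonicalTree N.G N.T N.r v))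

theorem exists_branchNode_or : (∃ x, IsBranchNode N.r (canonicalTree N.G N.T N.r v) x ∧
      level N.T N.r x = N.branchLev v ∧
      ∀ y, IsBranchNode N.r (canonicalTree N.G N.T N.r v) y → N.branchLev v ≤ level N.T N.r y) ∨
    ((∀ x, ¬ IsBranchNode N.r (canonicalTree N.G N.T N.r v) x) ∧ N.branchLev v = 0) := by
  by_cases h : ∃ x, IsBranchNode N.r (canonicalTree N.G N.T N.r v) x ∧
      ∀ y, IsBranchNode N.r (canonicalTree N.G N.T N.r v) y → level N.T N.r x ≤ level N.T N.r y
  · left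
    rw [branchLev, firstBranchNode, dif_pos h]
    exact ⟨_, h.choose_spec.1, rfl, h.choose_spec.2⟩
  · right
    constructor
    · intro x hx
      apply h
      obtain ⟨y, hy, hmin⟩ := (Set.toFinite
        {x | IsBranchNode N.r (canonicalTree N.G N.T N.r v) x}).exists_minimalFor
        (level N.T N.r) _ ⟨x, hx⟩
      refine ⟨y, hy, fun z hz => ?_⟩
      by_contra! hlt
      exact absurd (hmin hz hlt.le) (by omega)
    · rw [branchLev, firstBranchNode, dif_neg h, level_root]

theorem card_kids_canon_le_of_lt {p : N.V} (h : level N.T N.r p < N.branchLev v) :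
    (kids N.par (N.canon v) (N.ident p)).card ≤ 1 := by
  by_contra! hlt
  have hb := (isBranchNode_iff (v := v) p).2 hlt
  rcases exists_branchNode_or (v := v) with ⟨x, -, -, hmin⟩ | ⟨hno, -⟩
  · have := hmin p hb
    omega
  · exact hno p hb

theorem branchingNumber_root :
    branchingNumber N.r (canonicalTree N.G N.T N.r v) N.r = 1 := by
  rw [branchingNumber, level_root, branchingAux]

theorem branchingNumber_of_parent {b p : N.V} (hp : parent N.T N.r b = some p)
    (hpv : p ∈ (canonicalTree N.G N.T N.r v).verts) :
    branchingNumber N.r (canonicalTree N.G N.T N.r v) b =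
      if level N.T N.r b ≤ N.branchLev v then 1 else
        ((kids N.par (N.canon v) (N.ident p)).card : ℤ) + (if p = N.r then 0 else 1) +
          branchingNumber N.r (canonicalTree N.G N.T N.r v) p - 2 := by
  have h := ncard_neighborSet hpv
  rw [branchingNumber, level_of_parent isTree hp, branchingAux, hp, ← level_of_parent isTree hp]
  simp only [h]
  push_cast
  rfl

/-- Above the first branch node nobody has two children, so the sum is 0 and the branching number 1.
Further down both grow by degree - 2 = children - 1 per step, which preserves the difference 1. If
the recursion starts at the root, the missing parent edge makes the first increment smaller by one,
and the two numbers agree from then on. -/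
theorem branchingNumber_of_reach {k j m : ℕ} {A : Finset ℕ}
    (h : Reach N.par (N.canon v) ∅ k j A m) : ∀ b, N.ident b = j →
      (level N.T N.r b ≤ N.branchLev v → m = 0) ∧
      branchingNumber N.r (canonicalTree N.G N.T N.r v) b =
        if level N.T N.r b ≤ N.branchLev v then 1
        else (m : ℤ) + if N.branchLev v = 0 then 0 else 1 := by
  induction h with
  | root _ h0 =>
    rintro b rfl
    rw [par_ident_eq_none_iff] at h0
    subst h0
    rw [branchingNumber_root, level_root]
    simp
  | @step p c m A hpr _ hc hp _ ih =>
    rintro b rfl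
    have h1 := one_le_card_kids hc hp
    obtain ⟨q, hq, rfl⟩ := exists_of_par_ident hp
    have hqv := ident_mem_canon.1 hpr.mem
    obtain ⟨ih1, ih2⟩ := ih q rfl
    have hl := level_of_parent isTree hq
    rw [branchingNumber_of_parent hq hqv]
    by_cases hb : level N.T N.r b ≤ N.branchLev v
    · have h2 := card_kids_canon_le_of_lt (v := v) (p := q) (by omega)
      have h3 := ih1 (by omega)
      simp only [hb, if_true, and_true, true_implies]
      omega
    · refine ⟨fun h => absurd h hb, ?_⟩
      rw [if_neg hb, if_neg hb, ih2]
      by_cases hqr : q = N.r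
      · subst hqr
        rw [level_root] at hl ih1
        have h3 := ih1 (by omega)
        have h4 : N.branchLev v = 0 := by omega
        rw [level_root]
        simp only [h4, le_refl, if_true]
        omega
      · have hq0 : level N.T N.r q ≠ 0 := fun h => hqr ((level_eq_zero_iff isTree).1 h)
        rw [if_neg hqr]
        by_cases hql : level N.T N.r q ≤ N.branchLev v
        · have h3 := ih1 hql
          rw [if_pos hql, if_neg (by omega)]
          omega
        · rw [if_neg hql]
          split_ifs <;> omega

/-- The branching number is never below the sum, so small branching numbers give core nodes. The
alternative about levels puts the first branch node into the core for every k, including k = 0. -/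
theorem inCore_of_branchingNumber_le {k : ℕ} {b : N.V} :
    b ∈ (canonicalTree N.G N.T N.r v).verts →
    (level N.T N.r b ≤ N.branchLev v ∨
      branchingNumber N.r (canonicalTree N.G N.T N.r v) b ≤ k) →
    InCore N.par (N.canon v) k (N.ident b) := by
  induction b using induction_parent (r := N.r) N.bfs.isTree with
  | root =>
    intro h _
    exact ⟨_, _, .root (ident_mem_canon.2 h) (par_ident_eq_none_iff.2 rfl)⟩
  | step b q hq ih =>
    intro hb h
    have hqv := canonicalTree_closed isTree hb hq
    have hl := level_of_parent isTree hq
    have h1 := one_le_card_kids (ident_mem_canon.2 hb) (par_ident_eq_some_iff.2 hq)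
    have hrec := branchingNumber_of_parent hq hqv
    suffices h : ∃ A m, Reach N.par (N.canon v) ∅ k (N.ident q) A m ∧
        m + (kids N.par (N.canon v) (N.ident q)).card ≤ k + 1 by
      obtain ⟨A, m, hr, hle⟩ := h
      exact ⟨_, _, .step hr (by simp) (ident_mem_canon.2 hb) (par_ident_eq_some_iff.2 hq) hle⟩
    by_cases hbl : level N.T N.r b ≤ N.branchLev v
    · obtain ⟨A, m, hr⟩ := ih hqv (.inl (by omega))
      have h2 := (branchingNumber_of_reach hr q rfl).1 (by omega)
      have h3 := card_kids_canon_le_of_lt (v := v) (p := q) (by omega)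
      exact ⟨A, m, hr, by omega⟩
    · have hbk := h.resolve_left hbl
      rw [if_neg hbl] at hrec
      by_cases hql : level N.T N.r q ≤ N.branchLev v
      · obtain ⟨A, m, hr⟩ := ih hqv (.inl hql)
        obtain ⟨h2, h3⟩ := branchingNumber_of_reach hr q rfl
        have h4 := h2 hql
        rw [if_pos hql] at h3
        refine ⟨A, m, hr, ?_⟩
        split_ifs at hrec <;> omega
      · have hq0 : q ≠ N.r := by
          rintro rfl
          rw [level_root] at hql
          omega
        rw [if_neg hq0] at hrec
        obtain ⟨A, m, hr⟩ := ih hqv (.inr (by omega))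
        have h3 := (branchingNumber_of_reach hr q rfl).2
        rw [if_neg hql] at h3
        refine ⟨A, m, hr, ?_⟩
        split_ifs at h3 <;> omega

/-- The nodes of the truncated canonical tree. -/
theorem branchingNumber_le_iff {k : ℕ} {b : N.V} :
    b ∈ (canonicalTree N.G N.T N.r v).verts ∧
      branchingNumber N.r (canonicalTree N.G N.T N.r v) b ≤ k ↔
    ∃ A m, Reach N.par (N.canon v) ∅ k (N.ident b) A m ∧
      m + (if N.branchLev v = 0 then 0 else 1) ≤ k ∧ (k = 0 → N.par (N.ident b) ≠ none) := by
  rw [Ne, par_ident_eq_none_iff]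
  constructor
  · rintro ⟨hb, hle⟩
    obtain ⟨A, m, hr⟩ := inCore_of_branchingNumber_le hb (.inr hle)
    refine ⟨A, m, hr, ?_⟩
    obtain ⟨h1, h2⟩ := branchingNumber_of_reach hr b rfl
    by_cases hl : level N.T N.r b ≤ N.branchLev v
    · have h3 := h1 hl
      rw [if_pos hl] at h2
      refine ⟨?_, by omega⟩
      split_ifs <;> omega
    · rw [if_neg hl] at h2
      refine ⟨by split_ifs at h2 ⊢ <;> omega, ?_⟩
      rintro - rfl
      rw [level_root] at hl
      omega
  · rintro ⟨A, m, hr, hle, h0⟩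
    refine ⟨ident_mem_canon.1 hr.mem, ?_⟩
    obtain ⟨h1, h2⟩ := branchingNumber_of_reach hr b rfl
    rw [h2]
    by_cases hl : level N.T N.r b ≤ N.branchLev v
    · rw [if_pos hl]
      -- The root has branching number 1 although its sum is 0, so for k = 0 it must be excluded
      -- separately.
      have hk : k ≠ 0 := by
        rintro rfl
        refine h0 rfl ((level_eq_zero_iff isTree).1 ?_)
        split_ifs at hle with h3 <;> omega
      omega
    · rw [if_neg hl]
      split_ifs at hle ⊢ <;> omega

/-- The first branch node has sum 0 and so belongs to the core. Whether it is the root, or is absent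
altogether, can therefore be seen inside the core, where the offset is needed. -/
theorem branchLev_eq_zero_iff (k : ℕ) : N.branchLev v = 0 ↔
    (∀ j, InCore N.par (N.canon v) k j → ¬ 2 ≤ (kids N.par (N.canon v) j).card) ∨
    ∃ j, InCore N.par (N.canon v) k j ∧ N.par j = none ∧
      2 ≤ (kids N.par (N.canon v) j).card := by
  constructor
  · intro h0
    rcases exists_branchNode_or (v := v) with ⟨x, hx, hxl, -⟩ | ⟨hno, -⟩
    · rw [h0, level_eq_zero_iff isTree] at hxl
      subst hxl
      exact .inr ⟨N.ident N.r, inCore_of_branchingNumber_le (root_mem_canonicalTree isTree v)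
        (.inl (by rw [level_root]; omega)), par_ident_eq_none_iff.2 rfl, (isBranchNode_iff _).1 hx⟩
    · left
      rintro j ⟨A, m, hj⟩ h2
      obtain ⟨u, rfl⟩ := exists_of_mem_canon hj.mem
      exact hno u ((isBranchNode_iff u).2 h2)
  · rcases exists_branchNode_or (v := v) with ⟨x, hx, hxl, hmin⟩ | ⟨-, h0⟩
    · rintro (h | ⟨j, ⟨A, m, hj⟩, hj0, h2⟩)
      · have h2 := (isBranchNode_iff (v := v) x).1 hx
        refine absurd h2 (h _ (inCore_of_branchingNumber_le ?_ (.inl hxl.le)))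
        obtain ⟨c, hc⟩ : {c | (canonicalTree N.G N.T N.r v).Adj x c ∧
            parent N.T N.r c = some x}.Nonempty := by
          rw [← Set.ncard_pos]
          exact lt_of_lt_of_le (by omega) hx
        exact hc.1.fst_mem
      · obtain ⟨u, rfl⟩ := exists_of_mem_canon hj.mem
        rw [par_ident_eq_none_iff] at hj0
        subst hj0
        have := hmin N.r ((isBranchNode_iff _).2 h2)
        rw [level_root] at this
        omega
    · exact fun _ => h0

end Branching

end Network

/-! ### The local computations -/

namespace BlockState

open Classical Table Forest

/-- A number that encodes an optional number. -/
def code : Option ℕ → ℕ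
  | none => 0
  | some j => j + 1

/-- The inverse of `code`. -/
def uncode : ℕ → Option ℕ
  | 0 => none
  | j + 1 => some j

theorem uncode_code (x : Option ℕ) : uncode (code x) = x := by cases x <;> rfl

variable (st : BlockState)

/-- The identifiers of the children, which have announced their parents in block `0`. -/
noncomputable def kidIds : Finset ℕ :=
  st.input.nbrs.filter fun j => entry (st.hist 0 j) st.input.ident 0 = 1

/-- The identifiers of the neighbours that are not neighbours in the tree. -/
noncomputable def ntIds : Finset ℕ :=
  st.input.nbrs.filter fun j => st.input.parent ≠ some j ∧ j ∉ st.kidIds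

/-- The number of non-tree edges that start below the node, computed from the values of the
children. -/
noncomputable def volume : ℕ :=
  st.ntIds.card +
    ∑ j ∈ st.kidIds, entry (st.hist (st.height - st.input.level) j) st.input.ident 1

/-- The number of non-tree edges from below the node to below `b`, computed from the values that
the children have sent in block `i` in the given column. -/
noncomputable def count (i col b : ℕ) : ℕ :=
  (st.ntIds.filter fun j => b ∈ keys (st.hist 0 j)).card + ∑ j ∈ st.kidIds, entry (st.hist i j) b col

/-- The announcement of the ancestors and the parent. -/
noncomputable def ancTable : Finset (List ℕ) :=
  table st.input.ancestors fun j => [if st.input.parent = some j then 1 else 0]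

/-- The table of the numbers of edges to below the ancestors. -/
noncomputable def upTable : Finset (List ℕ) :=
  table st.input.ancestors fun j => [st.count (st.height - st.input.level) 0 j, st.volume]

/-- The table of parents, cut sizes and volumes of the ancestors. -/
noncomputable def downTable : Finset (List ℕ) :=
  table st.input.ancestors fun j =>
    if j = st.input.ident then
      [code st.input.parent,
        st.volume - st.count (st.height - st.input.level) 0 j +
          if st.input.parent ≠ none then 1 else 0, st.volume]
    else row (st.hist (st.height + 1 + st.input.level) (st.input.parent.getD 0)) j

/-- All rows about nodes that have been received by block `i`. -/
noncomputable def rows (i : ℕ) : Finset (List ℕ) :=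
  st.ntIds.biUnion (st.hist (2 * st.height + 2)) ∪ st.kidIds.biUnion (st.hist i) ∪ st.downTable

/-- The parents according to the received rows. -/
noncomputable def parents (i b : ℕ) : Option ℕ := uncode (entry (st.rows i) b 0)

/-- The nodes in the received parts of the canonical tree, and those in `S`. -/
noncomputable def nodes (i : ℕ) (S : Finset ℕ) : Finset ℕ :=
  st.ntIds.biUnion (fun j => keys (st.hist (2 * st.height + 2) j)) ∪
    st.kidIds.biUnion (fun j => keys (st.hist i j)) ∪ S

/-- The nodes that are marked as heavy by some child. -/
noncomputable def marked (i : ℕ) : Set ℕ := {b | ∃ j ∈ st.kidIds, entry (st.hist i j) b 4 = 1}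

/-- The nodes in the core of the tree that has been received, with ancestors and sums. -/
def Found (k i : ℕ) (S : Finset ℕ) : ℕ → Finset ℕ → ℕ → Prop :=
  Reach (st.parents i) (st.nodes i S) (st.marked i) k

/-- The table of the core of the tree that has been received. -/
noncomputable def coreTable (k i : ℕ) : Finset (List ℕ) :=
  table ((st.nodes i ∅).filter fun b => ∃ A m, st.Found k i ∅ b A m) fun b =>
    [entry (st.rows i) b 0, entry (st.rows i) b 1, entry (st.rows i) b 2, st.count i 3 b,
      if ∃ A m, st.Found k i ∅ b A m ∧ (b ∈ st.marked i ∨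
        k + 1 < m + (kids (st.parents i) (st.nodes i ∅) b).card) then 1 else 0]

/-- A branch node of the canonical tree. -/
def Branch (i b : ℕ) : Prop :=
  b ∈ st.marked i ∨ 2 ≤ (kids (st.parents i) (st.nodes i st.input.ancestors) b).card

/-- The first branch node of the canonical tree is the root. -/
def RootFirst (k i : ℕ) : Prop :=
  (∀ b A m, st.Found k i st.input.ancestors b A m → ¬ st.Branch i b) ∨
    ∃ b A m, st.Found k i st.input.ancestors b A m ∧ st.parents i b = none ∧ st.Branch i b

/-- The nodes of the truncated canonical tree. -/
noncomputable def sketchNodes (k i : ℕ) : Finset ℕ :=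
  (st.nodes i st.input.ancestors).filter fun b =>
    ∃ A m, st.Found k i st.input.ancestors b A m ∧
      m + (if st.RootFirst k i then 0 else 1) ≤ k ∧ (k = 0 → st.parents i b ≠ none)

/-- The number of edges in both the cut of the node and that of `b`. -/
noncomputable def gamma (k i b : ℕ) : ℕ :=
  if b ∈ st.input.ancestors then
    st.volume - st.count i 3 b + if b = st.input.ident ∧ st.input.parent ≠ none then 1 else 0
  else if ∃ A m, st.Found k i st.input.ancestors b A m ∧ st.input.ident ∈ A then
    entry (st.rows i) b 2 - st.count i 3 b
  else st.count i 3 b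

/-- The sketch. -/
noncomputable def sketch (k i : ℕ) : SketchData where
  verts := st.sketchNodes k i
  edges := ((st.sketchNodes k i ×ˢ st.sketchNodes k i).filter
    fun e => st.parents i e.2 = some e.1).image fun e => s(e.1, e.2)
  info := (st.sketchNodes k i).image fun b =>
    (b, entry (st.rows i) b 1, st.parents i b, st.gamma k i b)

/-- The broadcast in block `i`. -/
noncomputable def message (k i : ℕ) : Finset (List ℕ) :=
  if i = 0 then st.ancTable
  else if i ≤ st.height + 1 then
    if st.height + 1 ≤ i + st.input.level then st.upTable else ∅
  else if i ≤ 2 * st.height + 2 then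
    if st.height + 2 + st.input.level ≤ i then st.downTable else ∅
  else if 3 * st.height + 3 ≤ i + st.input.level then
    st.coreTable k (3 * st.height + 2 - st.input.level)
  else ∅

end BlockState

/-! ### Correctness of the local computations -/

namespace Network

open RootedTree Classical Forest Table BlockState

variable (N : Network)

/-- The cut size of the node with a given identifier. -/
noncomputable def etaId : ℕ → ℕ := N.atIdent (eta N.G N.T N.r) 0

/-- The volume of the node with a given identifier. -/
noncomputable def volId : ℕ → ℕ := N.atIdent N.vol 0

/-- The number of non-tree edges from below `v` to below the node with a given identifier. -/
noncomputable def cntId (v : N.V) : ℕ → ℕ := N.atIdent (N.cnt v) 0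

/-- The true value of `BlockState.ancTable`. -/
noncomputable def ancT (v : N.V) : Finset (List ℕ) :=
  table (N.anc v) fun j => [if N.par (N.ident v) = some j then 1 else 0]

/-- The true value of `BlockState.upTable`. -/
noncomputable def upT (v : N.V) : Finset (List ℕ) :=
  table (N.anc v) fun j => [N.cntId v j, N.vol v]

/-- The true value of `BlockState.downTable`. -/
noncomputable def downT (v : N.V) : Finset (List ℕ) :=
  table (N.anc v) fun j => [code (N.par j), N.etaId j, N.volId j]

/-- The true value of `BlockState.coreTable`. -/
noncomputable def coreT (k : ℕ) (v : N.V) : Finset (List ℕ) :=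
  table (core N.par (N.supp v) k) fun j => [code (N.par j), N.etaId j, N.volId j, N.cntId v j,
    if Heavy N.par (N.supp v) k j then 1 else 0]

/-- The true value of `BlockState.message`. -/
noncomputable def msgT (k i : ℕ) (v : N.V) : Finset (List ℕ) :=
  if i = 0 then N.ancT v
  else if i ≤ N.height + 1 then if N.height + 1 ≤ i + N.lev v then N.upT v else ∅
  else if i ≤ 2 * N.height + 2 then if N.height + 2 + N.lev v ≤ i then N.downT v else ∅
  else if 3 * N.height + 3 ≤ i + N.lev v then N.coreT k v else ∅

variable {N}

theorem adj_of_mem_children {v c : N.V} (h : c ∈ N.children v) : N.G.Adj v c :=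
  (adj_of_parent (mem_children.1 h)).symm

theorem adj_of_mem_ntNbrs {v y : N.V} (h : y ∈ N.ntNbrs v) : N.G.Adj v y := (mem_ntNbrs.1 h).1

theorem lev_of_mem_children {v c : N.V} (h : c ∈ N.children v) : N.lev c = N.lev v + 1 :=
  level_of_parent isTree (mem_children.1 h)

theorem ancestors_subset_of_mem_children {v c : N.V} (h : c ∈ N.children v) :
    ancestors N.T N.r v ⊆ ancestors N.T N.r c := by
  rw [ancestors_of_parent isTree (mem_children.1 h)]
  exact Set.subset_insert _ _

theorem input_parent (v : N.V) : (N.input v).parent = N.par (N.ident v) := by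
  rw [par_ident]; rfl

theorem input_ident (v : N.V) : (N.input v).ident = N.ident v := rfl

theorem input_level (v : N.V) : (N.input v).level = N.lev v := rfl

theorem input_ancestors (v : N.V) : (N.input v).ancestors = N.anc v := rfl

section Local

variable {st : BlockState} {v : N.V}

theorem ancTable_eq (hin : st.input = N.input v) : st.ancTable = N.ancT v := by
  rw [ancTable, hin, input_parent, input_ancestors]
  rfl

theorem kidIds_eq (hin : st.input = N.input v)
    (h0 : ∀ w, N.G.Adj v w → st.hist 0 (N.ident w) = N.ancT w) :
    st.kidIds = (N.children v).image N.ident := by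
  ext j
  rw [kidIds, hin, input_ident]
  simp only [Finset.mem_filter, Finset.mem_image, mem_input_nbrs]
  constructor
  · rintro ⟨⟨w, hw, rfl⟩, h⟩
    refine ⟨w, ?_, rfl⟩
    rw [h0 w hw, ancT] at h
    by_cases hm : N.ident v ∈ N.anc w
    · rw [entry_table hm] at h
      rw [mem_children, ← par_ident_eq_some_iff]
      by_contra hne
      simp [hne] at h
    · rw [entry_table_of_notMem hm] at h
      cases h
  · rintro ⟨w, hw, rfl⟩
    have hadj := adj_of_mem_children hw
    refine ⟨⟨w, hadj, rfl⟩, ?_⟩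
    have hm : N.ident v ∈ N.anc w :=
      ident_mem_anc.2 (ancestors_subset_of_mem_children hw (self_mem_ancestors isTree v))
    rw [h0 w hadj, ancT, entry_table hm, par_ident_eq_some_iff.2 (mem_children.1 hw)]
    simp

theorem ntIds_eq (hin : st.input = N.input v)
    (h0 : ∀ w, N.G.Adj v w → st.hist 0 (N.ident w) = N.ancT w) :
    st.ntIds = (N.ntNbrs v).image N.ident := by
  ext j
  rw [ntIds, kidIds_eq hin h0, hin, input_parent]
  simp only [Finset.mem_filter, Finset.mem_image, mem_input_nbrs]
  constructor
  · rintro ⟨⟨w, hw, rfl⟩, h1, h2⟩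
    refine ⟨w, mem_ntNbrs.2 ⟨hw, fun h => ?_⟩, rfl⟩
    rcases (tree_adj_iff (r := N.r) isTree).1 h with h | h
    · exact h2 ⟨w, mem_children.2 h, rfl⟩
    · exact h1 (par_ident_eq_some_iff.2 h)
  · rintro ⟨w, hw, rfl⟩
    obtain ⟨h1, h2⟩ := mem_ntNbrs.1 hw
    refine ⟨⟨w, h1, rfl⟩, fun h => h2 ?_, ?_⟩
    · exact (tree_adj_iff (r := N.r) isTree).2 (.inr (par_ident_eq_some_iff.1 h))
    · rintro ⟨c, hc, h⟩
      rw [N.inj h] at hc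
      exact h2 ((tree_adj_iff (r := N.r) isTree).2 (.inl (mem_children.1 hc)))

theorem volume_eq (hH : st.height = N.height) (hin : st.input = N.input v)
    (h0 : ∀ w, N.G.Adj v w → st.hist 0 (N.ident w) = N.ancT w)
    (h1 : ∀ c ∈ N.children v, st.hist (N.height - N.lev v) (N.ident c) = N.upT c) :
    st.volume = N.vol v := by
  rw [volume, kidIds_eq hin h0, ntIds_eq hin h0, Finset.card_image_of_injective _ N.inj,
    Finset.sum_image N.inj.injOn, vol_eq, hH, hin, input_ident, input_level]
  congr 1
  refine Finset.sum_congr rfl fun c hc => ?_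
  have hm : N.ident v ∈ N.anc c :=
    ident_mem_anc.2 (ancestors_subset_of_mem_children hc (self_mem_ancestors isTree v))
  rw [h1 c hc, upT, entry_table hm]
  rfl

/-- This is `cnt_eq` evaluated locally: a non-tree neighbour is below u iff u is among the ancestors
it announced in block 0. Block and column are parameters because both upward phases use it. -/
theorem count_eq (hin : st.input = N.input v)
    (h0 : ∀ w, N.G.Adj v w → st.hist 0 (N.ident w) = N.ancT w) {i col : ℕ} {u : N.V}
    (h1 : ∀ c ∈ N.children v, entry (st.hist i (N.ident c)) (N.ident u) col = N.cnt c u) :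
    st.count i col (N.ident u) = N.cnt v u := by
  rw [count, kidIds_eq hin h0, ntIds_eq hin h0, Finset.sum_image N.inj.injOn, cnt_eq,
    Finset.filter_image, Finset.card_image_of_injective _ N.inj]
  congr 1
  · congr 1
    refine Finset.filter_congr fun y hy => ?_
    rw [h0 y (adj_of_mem_ntNbrs hy), ancT, keys_table, ident_mem_anc]
  · exact Finset.sum_congr rfl h1

theorem count_up_eq (hin : st.input = N.input v)
    (h0 : ∀ w, N.G.Adj v w → st.hist 0 (N.ident w) = N.ancT w)
    (h1 : ∀ c ∈ N.children v, st.hist (N.height - N.lev v) (N.ident c) = N.upT c) {u : N.V}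
    (hu : u ∈ ancestors N.T N.r v) :
    st.count (N.height - N.lev v) 0 (N.ident u) = N.cnt v u := by
  refine count_eq hin h0 fun c hc => ?_
  have hm : N.ident u ∈ N.anc c := ident_mem_anc.2 (ancestors_subset_of_mem_children hc hu)
  rw [h1 c hc, upT, entry_table hm]
  exact atIdent_ident _ _ u

theorem upTable_eq (hH : st.height = N.height) (hin : st.input = N.input v)
    (h0 : ∀ w, N.G.Adj v w → st.hist 0 (N.ident w) = N.ancT w)
    (h1 : ∀ c ∈ N.children v, st.hist (N.height - N.lev v) (N.ident c) = N.upT c) :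
    st.upTable = N.upT v := by
  refine table_congr (by rw [hin]; rfl) fun j hj => ?_
  obtain ⟨u, hu, rfl⟩ := mem_anc.1 hj
  rw [volume_eq hH hin h0 h1, hH, hin, input_level, count_up_eq hin h0 h1 hu, cntId,
    atIdent_ident]

theorem downTable_eq (hH : st.height = N.height) (hin : st.input = N.input v)
    (h0 : ∀ w, N.G.Adj v w → st.hist 0 (N.ident w) = N.ancT w)
    (h1 : ∀ c ∈ N.children v, st.hist (N.height - N.lev v) (N.ident c) = N.upT c)
    (h2 : ∀ p, parent N.T N.r v = some p →
      st.hist (N.height + 1 + N.lev v) (N.ident p) = N.downT p) :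
    st.downTable = N.downT v := by
  refine table_congr (by rw [hin]; rfl) fun j hj => ?_
  obtain ⟨u, hu, rfl⟩ := mem_anc.1 hj
  rw [hin, input_ident, input_parent, input_level, hH]
  by_cases h : N.ident u = N.ident v
  · obtain rfl := N.inj h
    rw [if_pos rfl, volume_eq hH hin h0 h1, count_up_eq hin h0 h1 hu, etaId, atIdent_ident, volId,
      atIdent_ident, eta_eq]
    simp only [par_ident, ne_eq, Option.map_eq_none_iff]
  · rw [if_neg h]
    cases hp : parent N.T N.r v with
    | none =>
      have hv := (parent_eq_none_iff isTree).1 hp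
      rw [hv, ancestors_root isTree, Set.mem_singleton_iff] at hu
      exact absurd (by rw [hu, hv]) h
    | some p =>
      rw [par_ident_eq_some_iff.2 hp]
      have hup : u ∈ ancestors N.T N.r p := by
        rw [ancestors_of_parent isTree hp] at hu
        exact hu.resolve_left fun h' => h (by rw [h'])
      rw [Option.getD_some, h2 p hp, downT, row_table (ident_mem_anc.2 hup)]

/-- What a node knows when it has received the tables of the parents, cut sizes and volumes of all
neighbours, and the core tables of its children in block `i`. -/
structure Informed (k i : ℕ) (st : BlockState) (v : N.V) : Prop where
  height : st.height = N.height
  input : st.input = N.input v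
  anc : ∀ w, N.G.Adj v w → st.hist 0 (N.ident w) = N.ancT w
  up : ∀ c ∈ N.children v, st.hist (N.height - N.lev v) (N.ident c) = N.upT c
  down_parent : ∀ p, parent N.T N.r v = some p →
    st.hist (N.height + 1 + N.lev v) (N.ident p) = N.downT p
  down : ∀ y ∈ N.ntNbrs v, st.hist (2 * N.height + 2) (N.ident y) = N.downT y
  core : ∀ c ∈ N.children v, st.hist i (N.ident c) = N.coreT k c

namespace Informed

variable {k i : ℕ} {S : Finset ℕ}

theorem kidIds_eq (h : Informed k i st v) : st.kidIds = (N.children v).image N.ident :=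
  Network.kidIds_eq h.input h.anc

theorem ntIds_eq (h : Informed k i st v) : st.ntIds = (N.ntNbrs v).image N.ident :=
  Network.ntIds_eq h.input h.anc

theorem volume_eq (h : Informed k i st v) : st.volume = N.vol v :=
  Network.volume_eq h.height h.input h.anc h.up

theorem downTable_eq (h : Informed k i st v) : st.downTable = N.downT v :=
  Network.downTable_eq h.height h.input h.anc h.up h.down_parent

theorem mem_rows_iff (h : Informed k i st v) {l : List ℕ} : l ∈ st.rows i ↔
    (∃ y ∈ N.ntNbrs v, l ∈ N.downT y) ∨ (∃ c ∈ N.children v, l ∈ N.coreT k c) ∨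
      l ∈ N.downT v := by
  rw [rows, h.kidIds_eq, h.ntIds_eq, h.downTable_eq, h.height]
  simp only [Finset.mem_union, Finset.mem_biUnion, Finset.mem_image, exists_exists_and_eq_and,
    or_assoc]
  refine or_congr (exists_congr fun y => and_congr_right fun hy => ?_)
    (or_congr_left (exists_congr fun c => and_congr_right fun hc => ?_))
  · rw [h.down y hy]
  · rw [h.core c hc]

theorem mem_nodes_iff (h : Informed k i st v) {b : ℕ} : b ∈ st.nodes i S ↔
    (∃ y ∈ N.ntNbrs v, b ∈ N.anc y) ∨ (∃ c ∈ N.children v, b ∈ Forest.core N.par (N.supp c) k) ∨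
      b ∈ S := by
  rw [nodes, h.kidIds_eq, h.ntIds_eq, h.height]
  simp only [Finset.mem_union, Finset.mem_biUnion, Finset.mem_image, exists_exists_and_eq_and,
    or_assoc]
  refine or_congr (exists_congr fun y => and_congr_right fun hy => ?_)
    (or_congr_left (exists_congr fun c => and_congr_right fun hc => ?_))
  · rw [h.down y hy, downT, keys_table]
  · rw [h.core c hc, coreT, keys_table]

theorem mem_marked_iff (h : Informed k i st v) {b : ℕ} : b ∈ st.marked i ↔
    ∃ c ∈ N.children v, Heavy N.par (N.supp c) k b := by
  rw [marked, h.kidIds_eq]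
  simp only [Set.mem_ofPred_eq, Finset.mem_image, exists_exists_and_eq_and]
  refine exists_congr fun c => and_congr_right fun hc => ?_
  rw [h.core c hc, coreT]
  by_cases hb : b ∈ Forest.core N.par (N.supp c) k
  · rw [entry_table hb]
    simp
  · rw [entry_table_of_notMem hb]
    simp only [zero_ne_one, false_iff]
    rintro ⟨A, m, hr, -⟩
    exact hb (mem_core.2 ⟨A, m, hr⟩)

/-- Rows from non-tree neighbours, from children and from the node's own table differ in length, but
their first three columns hold the same global values. -/
theorem row_spec (h : Informed k i st v) {b : ℕ} {l : List ℕ} (hl : b :: l ∈ st.rows i) :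
    l.getD 0 0 = code (N.par b) ∧ l.getD 1 0 = N.etaId b ∧ l.getD 2 0 = N.volId b := by
  rcases h.mem_rows_iff.1 hl with ⟨y, -, hl⟩ | ⟨c, -, hl⟩ | hl
  · obtain ⟨-, rfl⟩ := cons_mem_table_iff.1 hl
    exact ⟨rfl, rfl, rfl⟩
  · obtain ⟨-, rfl⟩ := cons_mem_table_iff.1 hl
    exact ⟨rfl, rfl, rfl⟩
  · obtain ⟨-, rfl⟩ := cons_mem_table_iff.1 hl
    exact ⟨rfl, rfl, rfl⟩

theorem exists_row (h : Informed k i st v) (hS : S ⊆ N.anc v) {b : ℕ} (hb : b ∈ st.nodes i S) :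
    ∃ l, b :: l ∈ st.rows i := by
  rcases h.mem_nodes_iff.1 hb with ⟨y, hy, hb⟩ | ⟨c, hc, hb⟩ | hb
  · exact ⟨_, h.mem_rows_iff.2 (.inl ⟨y, hy, cons_mem_table_iff.2 ⟨hb, rfl⟩⟩)⟩
  · exact ⟨_, h.mem_rows_iff.2 (.inr (.inl ⟨c, hc, cons_mem_table_iff.2 ⟨hb, rfl⟩⟩))⟩
  · exact ⟨_, h.mem_rows_iff.2 (.inr (.inr (cons_mem_table_iff.2 ⟨hS hb, rfl⟩)))⟩

theorem entry_rows_zero (h : Informed k i st v) (hS : S ⊆ N.anc v) {b : ℕ}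
    (hb : b ∈ st.nodes i S) : entry (st.rows i) b 0 = code (N.par b) :=
  entry_eq_of_forall (h.exists_row hS hb) fun _ hl => (h.row_spec hl).1

theorem entry_rows_one (h : Informed k i st v) (hS : S ⊆ N.anc v) {b : ℕ}
    (hb : b ∈ st.nodes i S) : entry (st.rows i) b 1 = N.etaId b :=
  entry_eq_of_forall (h.exists_row hS hb) fun _ hl => (h.row_spec hl).2.1

theorem entry_rows_two (h : Informed k i st v) (hS : S ⊆ N.anc v) {b : ℕ}
    (hb : b ∈ st.nodes i S) : entry (st.rows i) b 2 = N.volId b :=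
  entry_eq_of_forall (h.exists_row hS hb) fun _ hl => (h.row_spec hl).2.2

theorem parents_eq (h : Informed k i st v) (hS : S ⊆ N.anc v) {b : ℕ} (hb : b ∈ st.nodes i S) :
    st.parents i b = N.par b := by
  rw [parents, h.entry_rows_zero hS hb, uncode_code]

theorem kids_parents (h : Informed k i st v) (hS : S ⊆ N.anc v) (b : ℕ) :
    kids (st.parents i) (st.nodes i S) b = kids N.par (st.nodes i S) b :=
  Finset.filter_congr fun c hc => by rw [h.parents_eq hS hc]

variable (N) in
/-- The parts of the canonical tree that a node receives. -/
noncomputable def part (v : N.V) (S : Finset ℕ) : Option N.V → Finset ℕ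
  | none => S
  | some w => if w ∈ N.children v then N.supp w else if w ∈ N.ntNbrs v then N.anc w else ∅

theorem part_of_mem_children {c : N.V} (hc : c ∈ N.children v) : part N v S (some c) = N.supp c :=
  if_pos hc

theorem part_of_mem_ntNbrs {y : N.V} (hy : y ∈ N.ntNbrs v) : part N v S (some y) = N.anc y := by
  rw [part, if_neg, if_pos hy]
  intro hc
  exact (mem_ntNbrs.1 hy).2 ((tree_adj_iff (r := N.r) isTree).2 (.inl (mem_children.1 hc)))

/-- Nodes that are neither children nor non-tree neighbours index the empty part; the hypothesis on
`p` discards them. -/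
theorem exists_part_iff {p : Finset ℕ → Prop} (hp : ¬ p ∅) : (∃ w, p (part N v S w)) ↔
    (∃ y ∈ N.ntNbrs v, p (N.anc y)) ∨ (∃ c ∈ N.children v, p (N.supp c)) ∨ p S := by
  constructor
  · rintro ⟨w | w, hw⟩
    · exact .inr (.inr hw)
    · by_cases hc : w ∈ N.children v
      · rw [part_of_mem_children hc] at hw
        exact .inr (.inl ⟨w, hc, hw⟩)
      · by_cases hy : w ∈ N.ntNbrs v
        · rw [part_of_mem_ntNbrs hy] at hw
          exact .inl ⟨w, hy, hw⟩
        · rw [part, if_neg hc, if_neg hy] at hw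
          exact absurd hw hp
  · rintro (⟨y, hy, h⟩ | ⟨c, hc, h⟩ | h)
    · exact ⟨some y, by rwa [part_of_mem_ntNbrs hy]⟩
    · exact ⟨some c, by rwa [part_of_mem_children hc]⟩
    · exact ⟨none, h⟩

theorem mem_supp_iff {b : ℕ} : b ∈ N.supp v ↔
    (∃ y ∈ N.ntNbrs v, b ∈ N.anc y) ∨ ∃ c ∈ N.children v, b ∈ N.supp c := by
  by_cases hb : ∃ u, N.ident u = b
  · obtain ⟨u, rfl⟩ := hb
    simp only [ident_mem_supp, ident_mem_anc]
    rw [cnt_eq, Nat.add_pos_iff_pos_or_pos, Finset.card_pos, Finset.sum_pos_iff]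
    simp [Finset.Nonempty]
  · refine iff_of_false (fun h => hb (exists_of_mem_supp h)) ?_
    rintro (⟨y, -, h⟩ | ⟨c, -, h⟩)
    · exact hb (exists_of_mem_anc h)
    · exact hb (exists_of_mem_supp h)

/-- What v has received are exactly the cores and heavy nodes of the parts of `supp v ∪ S`; ancestor
sets are their own cores. The case S = ∅ serves the table for the parent, whose canonical tree need
not contain v; S = `anc v` serves the sketch of v. -/
theorem isMerge (h : Informed k i st v) (hS : S = ∅ ∨ S = N.anc v) :
    IsMerge N.par (part N v S) (N.supp v ∪ S) (st.nodes i S) (st.marked i) k := by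
  have hnotEmpty : ∀ b A m, ¬ Reach N.par ∅ ∅ k b A m :=
    fun b A m hr => absurd hr.mem (Finset.notMem_empty b)
  have hcl : Closed N.par S := by
    rcases hS with rfl | rfl
    · exact fun c hc => absurd hc (Finset.notMem_empty c)
    · exact closed_anc v
  have hcore : ∀ b, InCore N.par S k b ↔ b ∈ S := by
    intro b
    rcases hS with rfl | rfl
    · exact iff_of_false (fun ⟨A, m, hr⟩ => hnotEmpty b A m hr) (Finset.notMem_empty b)
    · exact inCore_anc_iff
  have hheavy : ∀ b, ¬ Heavy N.par S k b := by
    intro b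
    rcases hS with rfl | rfl
    · exact fun ⟨A, m, hr, _⟩ => hnotEmpty b A m hr
    · exact not_heavy_anc
  constructor
  · rintro (_ | w)
    · exact hcl
    · rw [part]
      split_ifs
      · exact closed_supp w
      · exact closed_anc w
      · exact fun c hc => absurd hc (Finset.notMem_empty c)
  · intro b
    rw [exists_part_iff (p := fun U => b ∈ U) (Finset.notMem_empty b), Finset.mem_union,
      mem_supp_iff, or_assoc]
  · intro b
    rw [exists_part_iff (p := fun U => InCore N.par U k b) fun ⟨A, m, hr⟩ => hnotEmpty b A m hr,
      h.mem_nodes_iff]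
    simp only [inCore_anc_iff, mem_core, hcore]
  · intro b
    rw [exists_part_iff (p := fun U => Heavy N.par U k b) fun ⟨A, m, hr, _⟩ => hnotEmpty b A m hr,
      h.mem_marked_iff]
    simp only [not_heavy_anc, hheavy, and_false, exists_false, or_false, false_or]

theorem subset_anc (hS : S = ∅ ∨ S = N.anc v) : S ⊆ N.anc v := by
  rcases hS with rfl | rfl
  · exact Finset.empty_subset _
  · exact subset_rfl

theorem found_iff (h : Informed k i st v) (hS : S = ∅ ∨ S = N.anc v) {b m : ℕ} {A : Finset ℕ} :
    st.Found k i S b A m ↔ Reach N.par (N.supp v ∪ S) ∅ k b A m := by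
  rw [Found, reach_congr fun j hj => h.parents_eq (subset_anc hS) hj, (h.isMerge hS).reach_iff]

/-- A missing row is read as 0, and this is right: if `cnt c u` were positive, u would lie in `supp
c`, and being in the core of the larger tree it would be in the core of `supp c` and have a row. -/
theorem count_core_eq (h : Informed k i st v) {u : N.V} {T : Finset ℕ} (hT : N.supp v ⊆ T)
    (hu : InCore N.par T k (N.ident u)) : st.count i 3 (N.ident u) = N.cnt v u := by
  refine count_eq h.input h.anc fun c hc => ?_
  rw [h.core c hc, coreT]
  by_cases hb : N.ident u ∈ Forest.core N.par (N.supp c) k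
  · rw [entry_table hb]
    exact atIdent_ident _ _ u
  · rw [entry_table_of_notMem hb]
    by_contra hne
    have hpos : N.ident u ∈ N.supp c := ident_mem_supp.2 (Nat.pos_of_ne_zero (Ne.symm hne))
    have hsub : N.supp c ⊆ T := fun b hb => hT (mem_supp_iff.2 (.inr ⟨c, hc, hb⟩))
    obtain ⟨A, m, hr⟩ := hu
    obtain ⟨m', -, hr'⟩ := hr.anti hsub (closed_supp c) hpos
    exact hb (mem_core.2 ⟨A, m', hr'⟩)

theorem coreTable_eq (h : Informed k i st v) : st.coreTable k i = N.coreT k v := by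
  have hS : (∅ : Finset ℕ) = ∅ ∨ ∅ = N.anc v := .inl rfl
  have hf : ∀ {b A m}, st.Found k i ∅ b A m ↔ Reach N.par (N.supp v) ∅ k b A m := by
    intro b A m
    rw [h.found_iff hS, Finset.union_empty]
  have hM := h.isMerge hS
  rw [Finset.union_empty] at hM
  refine table_congr ?_ fun b hb => ?_
  · ext b
    simp only [Finset.mem_filter, hf, mem_core]
    exact ⟨fun hb => hb.2, fun ⟨A, m, hr⟩ => ⟨hM.mem_cores_of_reach hr, A, m, hr⟩⟩
  · have hcore := mem_core.1 hb
    obtain ⟨A, m, hr⟩ := hcore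
    have hbn := hM.mem_cores_of_reach hr
    obtain ⟨u, rfl⟩ := exists_of_mem_supp hr.mem
    rw [h.entry_rows_zero (subset_anc hS) hbn, h.entry_rows_one (subset_anc hS) hbn,
      h.entry_rows_two (subset_anc hS) hbn, h.count_core_eq subset_rfl ⟨A, m, hr⟩,
      h.kids_parents (subset_anc hS), cntId, atIdent_ident]
    congr 5
    simp only [hf]
    refine if_congr ?_ rfl rfl
    refine exists_congr fun A => exists_congr fun m => and_congr_right fun hr => ?_
    rw [hM.heavy_iff hr]

theorem branch_iff (h : Informed k i st v) {b m : ℕ} {A : Finset ℕ}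
    (hr : Reach N.par (N.canon v) ∅ k b A m) :
    st.Branch i b ↔ 2 ≤ (kids N.par (N.canon v) b).card := by
  have hS : N.anc v = ∅ ∨ N.anc v = N.anc v := .inr rfl
  have hM := h.isMerge hS
  rw [Branch, h.input, input_ancestors, h.kids_parents (subset_anc hS), canon, hM.branch_iff hr]

theorem rootFirst_iff (h : Informed k i st v) : st.RootFirst k i ↔ N.branchLev v = 0 := by
  have hS : N.anc v = ∅ ∨ N.anc v = N.anc v := .inr rfl
  have hM := h.isMerge hS
  rw [branchLev_eq_zero_iff k, RootFirst, h.input, input_ancestors]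
  simp only [h.found_iff hS, InCore, forall_exists_index]
  refine or_congr ?_ ?_
  · refine forall_congr' fun b => forall_congr' fun A => forall_congr' fun m =>
      forall_congr' fun hr => ?_
    rw [h.branch_iff hr]
  · refine exists_congr fun b => ?_
    constructor
    · rintro ⟨A, m, hr, h0, hb⟩
      rw [h.parents_eq (subset_anc hS) (hM.mem_cores_of_reach hr)] at h0
      exact ⟨⟨A, m, hr⟩, h0, (h.branch_iff hr).1 hb⟩
    · rintro ⟨⟨A, m, hr⟩, h0, hb⟩
      refine ⟨A, m, hr, ?_, (h.branch_iff hr).2 hb⟩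
      rwa [h.parents_eq (subset_anc hS) (hM.mem_cores_of_reach hr)]

theorem inCore_of_mem_sketchNodes (h : Informed k i st v) {b : ℕ} (hb : b ∈ st.sketchNodes k i) :
    InCore N.par (N.canon v) k b := by
  obtain ⟨A, m, hf, -⟩ := (Finset.mem_filter.1 hb).2
  rw [h.input, input_ancestors, h.found_iff (.inr rfl)] at hf
  exact ⟨A, m, hf⟩

theorem mem_nodes_of_inCore (h : Informed k i st v) {b : ℕ} (hb : InCore N.par (N.canon v) k b) :
    b ∈ st.nodes i (N.anc v) := by
  obtain ⟨A, m, hr⟩ := hb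
  exact (h.isMerge (.inr rfl)).mem_cores_of_reach hr

theorem ident_mem_sketchNodes (h : Informed k i st v) {b : N.V} :
    N.ident b ∈ st.sketchNodes k i ↔
      b ∈ (trunc N.r (canonicalTree N.G N.T N.r v) k).verts := by
  have hS : N.anc v = ∅ ∨ N.anc v = N.anc v := .inr rfl
  change _ ↔ b ∈ (canonicalTree N.G N.T N.r v).verts ∧
    branchingNumber N.r (canonicalTree N.G N.T N.r v) b ≤ k
  rw [branchingNumber_le_iff, sketchNodes, Finset.mem_filter, h.input, input_ancestors]
  simp only [h.found_iff hS, h.rootFirst_iff]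
  constructor
  · rintro ⟨hn, A, m, hr, hle, h0⟩
    rw [h.parents_eq (subset_anc hS) hn] at h0
    exact ⟨A, m, hr, hle, h0⟩
  · rintro ⟨A, m, hr, hle, h0⟩
    have hn := h.mem_nodes_of_inCore ⟨A, m, hr⟩
    rw [← h.parents_eq (subset_anc hS) hn] at h0
    exact ⟨hn, A, m, hr, hle, h0⟩

theorem gamma_eq (h : Informed k i st v) {u : N.V} (hu : InCore N.par (N.canon v) k (N.ident u)) :
    st.gamma k i (N.ident u) = gam N.G (desc N.T N.r v) (desc N.T N.r u) := by
  have hS : N.anc v = ∅ ∨ N.anc v = N.anc v := .inr rfl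
  have hn := h.mem_nodes_of_inCore hu
  rw [gamma, gam_desc, h.count_core_eq Finset.subset_union_left hu, h.volume_eq,
    h.entry_rows_two (subset_anc hS) hn, volId, atIdent_ident, h.input, input_ancestors,
    input_parent, input_ident]
  have h1 : (∃ A m, st.Found k i (N.anc v) (N.ident u) A m ∧ N.ident v ∈ A) ↔
      v ∈ ancestors N.T N.r u := by
    simp only [h.found_iff hS]
    rw [← ident_mem_anc]
    constructor
    · rintro ⟨A, m, hr, hA⟩
      rwa [reach_ancestors hr u rfl] at hA
    · intro hA
      obtain ⟨A, m, hr⟩ := hu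
      exact ⟨A, m, hr, by rwa [reach_ancestors hr u rfl]⟩
  simp only [h1, ident_mem_anc, N.inj.eq_iff, ne_eq, par_ident, Option.map_eq_none_iff]

/-- The computed sketch is the `k`-Sketch. -/
theorem sketch_eq (h : Informed k i st v) :
    st.sketch k i = kSketch N.G N.T N.r N.ident k v := by
  have hS : N.anc v = ∅ ∨ N.anc v = N.anc v := .inr rfl
  have hmem : ∀ b, b ∈ st.sketchNodes k i ↔
      ∃ u ∈ (trunc N.r (canonicalTree N.G N.T N.r v) k).verts, N.ident u = b := by
    intro b
    constructor
    · intro hb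
      obtain ⟨A, m, hr⟩ := h.inCore_of_mem_sketchNodes hb
      obtain ⟨u, rfl⟩ := exists_of_mem_canon hr.mem
      exact ⟨u, h.ident_mem_sketchNodes.1 hb, rfl⟩
    · rintro ⟨u, hu, rfl⟩
      exact h.ident_mem_sketchNodes.2 hu
  have hpar : ∀ b ∈ st.sketchNodes k i, st.parents i b = N.par b := fun b hb =>
    h.parents_eq (subset_anc hS) (h.mem_nodes_of_inCore (h.inCore_of_mem_sketchNodes hb))
  unfold sketch kSketch
  simp only [SketchData.mk.injEq]
  refine ⟨?_, ?_, ?_⟩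
  · ext b
    rw [hmem, Set.Finite.mem_toFinset, Set.mem_image]
  · ext e
    rw [Set.Finite.mem_toFinset]
    simp only [Finset.mem_image, Finset.mem_filter, Finset.mem_product, Set.mem_image]
    constructor
    · rintro ⟨⟨x, y⟩, ⟨⟨hx, hy⟩, hxy⟩, rfl⟩
      rw [hpar y hy] at hxy
      obtain ⟨p, hp, rfl⟩ := (hmem x).1 hx
      obtain ⟨c, hc, rfl⟩ := (hmem y).1 hy
      rw [par_ident_eq_some_iff] at hxy
      refine ⟨s(p, c), ?_, rfl⟩
      rw [SimpleGraph.Subgraph.mem_edgeSet, trunc, SimpleGraph.Subgraph.induce_adj,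
        canonicalTree_adj isTree]
      exact ⟨hp, hc, hp.1, hc.1, ((parent_eq_some_iff isTree).1 hxy).1⟩
    · rintro ⟨e', he', rfl⟩
      induction e' using Sym2.ind with
      | _ a b =>
        have hab := SimpleGraph.Subgraph.mem_edgeSet.1 he'
        have ha := h.ident_mem_sketchNodes.2 hab.fst_mem
        have hb := h.ident_mem_sketchNodes.2 hab.snd_mem
        rcases (tree_adj_iff (r := N.r) isTree).1 hab.adj_sub with hp | hp
        · refine ⟨(N.ident a, N.ident b), ⟨⟨ha, hb⟩, ?_⟩, rfl⟩
          rw [hpar _ hb, par_ident_eq_some_iff.2 hp]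
        · refine ⟨(N.ident b, N.ident a), ⟨⟨hb, ha⟩, ?_⟩, Sym2.eq_swap⟩
          rw [hpar _ ha, par_ident_eq_some_iff.2 hp]
  · ext x
    rw [Set.Finite.mem_toFinset]
    simp only [Finset.mem_image, Set.mem_image]
    have key : ∀ u, N.ident u ∈ st.sketchNodes k i →
        (N.ident u, entry (st.rows i) (N.ident u) 1, st.parents i (N.ident u),
          st.gamma k i (N.ident u)) =
        (N.ident u, eta N.G N.T N.r u, (parent N.T N.r u).map N.ident,
          gam N.G (desc N.T N.r v) (desc N.T N.r u)) := by
      intro u hu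
      have hc := h.inCore_of_mem_sketchNodes hu
      rw [h.entry_rows_one (subset_anc hS) (h.mem_nodes_of_inCore hc), hpar _ hu, par_ident,
        h.gamma_eq hc, etaId, atIdent_ident]
    constructor
    · rintro ⟨b, hb, rfl⟩
      obtain ⟨u, hu, rfl⟩ := (hmem b).1 hb
      exact ⟨u, hu, (key u hb).symm⟩
    · rintro ⟨u, hu, rfl⟩
      have hb := h.ident_mem_sketchNodes.2 hu
      exact ⟨N.ident u, hb, key u hb⟩

end Informed

end Local

end Network

/-! ### The schedule and the size of the messages -/

namespace Network

open RootedTree Classical Forest Table BlockState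

variable {N : Network} {k : ℕ}

theorem blockView_hist {Y : ℕ → N.V → Finset (List ℕ)} {i n : ℕ} (hi : i < n) {v w : N.V}
    (h : N.G.Adj v w) : (N.blockView Y n v).hist i (N.ident w) = Y i w := by
  simp only [blockView, hi, if_true, heard_ident _ _ h]

theorem msgT_zero (v : N.V) : N.msgT k 0 v = N.ancT v := if_pos rfl

theorem msgT_up {v c : N.V} (hc : c ∈ N.children v) :
    N.msgT k (N.height - N.lev v) c = N.upT c := by
  have h1 := lev_of_mem_children hc
  have h2 := lev_le_height c
  rw [msgT, if_neg (by omega), if_pos (by omega), if_pos (by omega)]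

theorem msgT_down_parent {v p : N.V} (hp : parent N.T N.r v = some p) :
    N.msgT k (N.height + 1 + N.lev v) p = N.downT p := by
  have h1 : N.lev v = N.lev p + 1 := level_of_parent isTree hp
  have h2 := lev_le_height v
  rw [msgT, if_neg (by omega), if_neg (by omega), if_pos (by omega), if_pos (by omega)]

theorem msgT_down (v : N.V) : N.msgT k (2 * N.height + 2) v = N.downT v := by
  have h2 := lev_le_height v
  rw [msgT, if_neg (by omega), if_neg (by omega), if_pos (by omega), if_pos (by omega)]

theorem msgT_core {v : N.V} {i : ℕ} (hi : 3 * N.height + 3 ≤ i + N.lev v) :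
    N.msgT k i v = N.coreT k v := by
  have h2 := lev_le_height v
  rw [msgT, if_neg (by omega), if_neg (by omega), if_neg (by omega), if_pos (by omega)]

/-- The condition `hic` says that in block i all children already send their final core tables. -/
theorem informed_blockView {v : N.V} {i n : ℕ} (hn : 2 * N.height + 2 < n) (hi : i < n)
    (hic : ∀ c ∈ N.children v, 3 * N.height + 3 ≤ i + N.lev c) :
    Informed k i (N.blockView (N.msgT k) n v) v where
  height := rfl
  input := rfl
  anc w hw := by rw [blockView_hist (by omega) hw, msgT_zero]
  up c hc := by rw [blockView_hist (by omega) (adj_of_mem_children hc), msgT_up hc]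
  down_parent p hp := by
    have := lev_le_height v
    rw [blockView_hist (by omega) (adj_of_parent hp), msgT_down_parent hp]
  down y hy := by rw [blockView_hist hn (adj_of_mem_ntNbrs hy), msgT_down]
  core c hc := by rw [blockView_hist hi (adj_of_mem_children hc), msgT_core (hic c hc)]

/-- A node of level l starts in block H + 1 - l on the way up, H + 2 + l on the way down and 3H + 3
- l with the cores, and repeats its table until the phase ends. Each start is one block after the
start of the nodes it depends on: children, parent, children. By block 2H + 2 everybody sends the
down table, so it also crosses the non-tree edges. -/
theorem message_blockView (i : ℕ) (v : N.V) :
    (N.blockView (N.msgT k) i v).message k i = N.msgT k i v := by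
  have hin : (N.blockView (N.msgT k) i v).input = N.input v := rfl
  have hH : (N.blockView (N.msgT k) i v).height = N.height := rfl
  have hl := lev_le_height v
  have hanc : i ≠ 0 → ∀ w, N.G.Adj v w →
      (N.blockView (N.msgT k) i v).hist 0 (N.ident w) = N.ancT w := fun hi w hw => by
    rw [blockView_hist (by omega) hw, msgT_zero]
  have hup : N.height - N.lev v < i → ∀ c ∈ N.children v,
      (N.blockView (N.msgT k) i v).hist (N.height - N.lev v) (N.ident c) = N.upT c :=
    fun hi c hc => by rw [blockView_hist hi (adj_of_mem_children hc), msgT_up hc]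
  rw [message, msgT, hH, hin, input_level]
  split_ifs with h1 h2 h3 h4 h5 h6
  · exact ancTable_eq hin
  · exact upTable_eq hH hin (hanc h1) (hup (by omega))
  · rfl
  · exact downTable_eq hH hin (hanc h1) (hup (by omega)) fun p hp => by
      rw [blockView_hist (by omega) (adj_of_parent hp), msgT_down_parent hp]
  · rfl
  · refine (informed_blockView (by omega) (by omega) fun c hc => ?_).coreTable_eq
    have h8 := lev_of_mem_children hc
    omega
  · rfl

theorem sketch_blockView (v : N.V) :
    (N.blockView (N.msgT k) (3 * N.height + 3) v).sketch k (3 * N.height + 2) =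
      kSketch N.G N.T N.r N.ident k v := by
  refine (informed_blockView (by omega) (by omega) fun c hc => ?_).sketch_eq
  have h8 := lev_of_mem_children hc
  omega

theorem nil_notMem_msgT (i : ℕ) (v : N.V) : [] ∉ N.msgT k i v := by
  unfold msgT
  split_ifs <;> first | exact nil_notMem_table _ _ | exact Finset.notMem_empty _

theorem card_anc_le (v : N.V) : (N.anc v).card ≤ N.height + 1 := by
  have h : (N.anc v).card ≤ (Finset.range (N.height + 1)).card := by
    refine Finset.card_le_card_of_injOn (N.atIdent N.lev 0) ?_ ?_
    · intro j hj
      obtain ⟨u, -, rfl⟩ := mem_anc.1 hj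
      have := lev_le_height u
      rw [atIdent_ident]
      simp only [Finset.coe_range, Set.mem_Iio]
      omega
    · intro j hj j' hj' h
      obtain ⟨u, hu, rfl⟩ := mem_anc.1 hj
      obtain ⟨u', hu', rfl⟩ := mem_anc.1 hj'
      rw [atIdent_ident, atIdent_ident] at h
      unfold lev at h
      rcases ancestors_total isTree hu hu' with h' | h'
      · rw [eq_of_mem_ancestors_of_level isTree h' h.ge]
      · rw [eq_of_mem_ancestors_of_level isTree h' h.le]
  rwa [Finset.card_range] at h

theorem card_core_supp_le (v : N.V) :
    (core N.par (N.supp v) k).card ≤ (N.height + 1) * 2 ^ k := by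
  refine card_core_le (lvl := N.atIdent N.lev 0) ?_ ?_ ?_ ?_
  · intro b hb b' hb' h h'
    obtain ⟨u, rfl⟩ := exists_of_mem_supp hb
    obtain ⟨u', rfl⟩ := exists_of_mem_supp hb'
    rw [par_ident_eq_none_iff] at h h'
    rw [h, h']
  · intro b hb h
    obtain ⟨u, rfl⟩ := exists_of_mem_supp hb
    rw [par_ident_eq_none_iff] at h
    rw [h, atIdent_ident]
    exact level_root
  · intro c hc p hp
    obtain ⟨u, rfl⟩ := exists_of_mem_supp hc
    obtain ⟨q, hq, rfl⟩ := exists_of_par_ident hp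
    rw [atIdent_ident, atIdent_ident]
    exact level_of_parent isTree hq
  · intro b hb
    obtain ⟨u, rfl⟩ := exists_of_mem_supp hb
    rw [atIdent_ident]
    exact lev_le_height u

theorem card_msgT_le (i : ℕ) (v : N.V) : (N.msgT k i v).card ≤ (N.height + 1) * 2 ^ k := by
  have h : (N.anc v).card ≤ (N.height + 1) * 2 ^ k :=
    (card_anc_le v).trans (Nat.le_mul_of_pos_right _ (Nat.two_pow_pos k))
  unfold msgT
  split_ifs
  · exact (card_table_le _ _).trans h
  · exact (card_table_le _ _).trans h
  · simp
  · exact (card_table_le _ _).trans h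
  · simp
  · exact (card_table_le _ _).trans (card_core_supp_le v)
  · simp

/-! ### Bit lengths of the messages. -/

theorem size_le_of_le {n x : ℕ} (h : x ≤ n ^ 2 + 1) : x.size ≤ 3 * (Nat.log 2 n + 1) := by
  rw [Nat.size_le]
  have h1 : n < 2 ^ (Nat.log 2 n + 1) := Nat.lt_pow_succ_log_self (by omega) n
  have h2 : 2 ≤ 2 ^ (Nat.log 2 n + 1) := by
    rw [pow_succ]
    have := Nat.one_le_two_pow (n := Nat.log 2 n)
    omega
  rw [mul_comm, pow_mul]
  -- With n < q and q ≥ 2 one has n^2 + 1 ≤ q^2 < q^3, whence the factor 3.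
  generalize 2 ^ (Nat.log 2 n + 1) = q at *
  have h3 : n ^ 2 + 1 ≤ q ^ 2 := by nlinarith
  have h4 : q ^ 2 < q ^ 3 := Nat.pow_lt_pow_right (by omega) (by omega)
  omega

theorem eta_le (u : N.V) : eta N.G N.T N.r u ≤ Fintype.card N.V ^ 2 + 1 := by
  rw [eta_eq]
  have := vol_le u
  split_ifs <;> omega

theorem size_le_of_small {a : ℕ} {x : ℕ} (h : x ≤ Fintype.card N.V ^ 2 + 1) :
    x.size ≤ (a + 3) * (Nat.log 2 (Fintype.card N.V) + 1) :=
  (size_le_of_le h).trans (Nat.mul_le_mul_right _ (by omega))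

theorem size_code_le {a : ℕ}
    (hid : ∀ v : N.V, (N.ident v).size ≤ a * (Nat.log 2 (Fintype.card N.V) + 1)) (u : N.V) :
    (code (N.par (N.ident u))).size ≤ (a + 3) * (Nat.log 2 (Fintype.card N.V) + 1) := by
  rw [par_ident]
  cases parent N.T N.r u with
  | none => exact (Nat.size_zero.le).trans (Nat.zero_le _)
  | some p =>
    have h1 := hid p
    have h2 : (N.ident p + 1).size ≤ (N.ident p).size + 1 := by
      rw [Nat.size_le, pow_succ]
      have := Nat.lt_size_self (N.ident p)
      omega
    change (N.ident p + 1).size ≤ _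
    refine h2.trans ?_
    rw [add_mul]
    omega

theorem mem_msgT {k i : ℕ} {v : N.V} {l : List ℕ} (hl : l ∈ N.msgT k i v) :
    ∃ u : N.V, l = [N.ident u, if N.par (N.ident v) = some (N.ident u) then 1 else 0] ∨
      l = [N.ident u, N.cnt v u, N.vol v] ∨
      l = [N.ident u, code (N.par (N.ident u)), eta N.G N.T N.r u, N.vol u] ∨
      l = [N.ident u, code (N.par (N.ident u)), eta N.G N.T N.r u, N.vol u, N.cnt v u,
        if Heavy N.par (N.supp v) k (N.ident u) then 1 else 0] := by
  unfold msgT at hl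
  split_ifs at hl
  · obtain ⟨j, hj, rfl⟩ := Finset.mem_image.1 hl
    obtain ⟨u, rfl⟩ := exists_of_mem_anc hj
    exact ⟨u, .inl rfl⟩
  · obtain ⟨j, hj, rfl⟩ := Finset.mem_image.1 hl
    obtain ⟨u, rfl⟩ := exists_of_mem_anc hj
    exact ⟨u, .inr (.inl (by simp only [cntId, atIdent_ident]))⟩
  · simp at hl
  · obtain ⟨j, hj, rfl⟩ := Finset.mem_image.1 hl
    obtain ⟨u, rfl⟩ := exists_of_mem_anc hj
    exact ⟨u, .inr (.inr (.inl (by simp only [etaId, volId, atIdent_ident])))⟩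
  · simp at hl
  · obtain ⟨j, hj, rfl⟩ := Finset.mem_image.1 hl
    obtain ⟨A, m, hr⟩ := mem_core.1 hj
    obtain ⟨u, rfl⟩ := exists_of_mem_supp hr.mem
    exact ⟨u, .inr (.inr (.inr (by
      simp only [etaId, volId, cntId, atIdent_ident])))⟩
  · simp at hl

/-- Six is the length of the longest row: a key and the five columns of a core table. -/
theorem length_encode_le_of_size {a : ℕ} {l : List ℕ} (hlen : l.length ≤ 6)
    (h : ∀ x ∈ l, x.size ≤ (a + 3) * (Nat.log 2 (Fintype.card N.V) + 1)) :
    (BitCode.encode l).length ≤ 6 * (2 * (a + 3) + 1) * (Nat.log 2 (Fintype.card N.V) + 1) := by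
  refine (BitCode.length_encode_le h).trans ((Nat.mul_le_mul_right _ hlen).trans ?_)
  nlinarith

theorem length_encode_msgT_le {a : ℕ}
    (hid : ∀ v : N.V, (N.ident v).size ≤ a * (Nat.log 2 (Fintype.card N.V) + 1)) {i : ℕ} {v : N.V}
    {l : List ℕ} (hl : l ∈ N.msgT k i v) :
    (BitCode.encode l).length ≤ 6 * (2 * (a + 3) + 1) * (Nat.log 2 (Fintype.card N.V) + 1) := by
  obtain ⟨u, h⟩ := mem_msgT hl
  have h1 : (N.ident u).size ≤ (a + 3) * (Nat.log 2 (Fintype.card N.V) + 1) :=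
    (hid u).trans (Nat.mul_le_mul_right _ (by omega))
  have h2 := size_code_le hid u
  have h3 := size_le_of_small (N := N) (a := a) (eta_le u)
  have h4 := fun w => size_le_of_small (N := N) (a := a) ((vol_le w).trans (Nat.le_succ _))
  have h5 := size_le_of_small (N := N) (a := a) ((cnt_le v u).trans (Nat.le_succ _))
  have h6 : ∀ (p : Prop) [Decidable p], (if p then 1 else 0 : ℕ).size ≤
      (a + 3) * (Nat.log 2 (Fintype.card N.V) + 1) := fun p _ =>
    size_le_of_small (by split_ifs <;> omega)
  refine length_encode_le_of_size ?_ ?_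
  · rcases h with rfl | rfl | rfl | rfl <;> simp
  · rcases h with rfl | rfl | rfl | rfl <;> simp only [List.forall_mem_cons] <;>
      simp [h1, h2, h3, h4, h5, h6]

theorem height_lt_card : N.height < Fintype.card N.V := by
  obtain ⟨v, hv⟩ := exists_lev_eq_of_le (N := N) le_rfl
  obtain ⟨p, hp, hlen⟩ := (isTree (N := N)).connected.exists_path_of_dist N.r v
  have := hp.length_lt
  unfold lev level at hv
  omega

theorem length_encode_floodMsg_le (a t : ℕ) (v : N.V) :
    (BitCode.encode (N.floodMsg t v)).length ≤
      6 * (2 * (a + 3) + 1) * (Nat.log 2 (Fintype.card N.V) + 1) := by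
  have h0 := maxLev_le_height t v
  have h1 := height_lt_card (N := N)
  have h2 : (N.maxLev t v).size ≤ (a + 3) * (Nat.log 2 (Fintype.card N.V) + 1) :=
    size_le_of_small (by nlinarith)
  have h6 : ∀ (p : Prop) [Decidable p], (if p then 1 else 0 : ℕ).size ≤
      (a + 3) * (Nat.log 2 (Fintype.card N.V) + 1) := fun p _ =>
    size_le_of_small (by split_ifs <;> omega)
  refine length_encode_le_of_size (by simp [floodMsg]) ?_
  simp only [floodMsg, List.forall_mem_cons]
  simp [h2, h6]

/-! ### The number of rounds. -/

theorem height_le_diam : N.height ≤ N.G.diam := by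
  have : Nonempty N.V := ⟨N.r⟩
  refine Finset.sup_le fun v _ => ?_
  rw [lev, level, N.bfs.dist_eq]
  exact SimpleGraph.dist_le_diam (SimpleGraph.connected_iff_ediam_ne_top.1 N.conn)

/-- With at least two nodes the diameter d is at least 1, so lower-order terms are absorbed: 2H + 1
≤ 3 * d^2, and H + 1 ≤ 2 * d gives the 12. -/
theorem rounds_le [Nontrivial N.V] :
    2 * N.height + 1 + (3 * N.height + 3) * ((N.height + 1) * 2 ^ k) ≤
      (3 + 12 * 2 ^ k) * N.G.diam ^ 2 := by
  have h1 := height_le_diam (N := N)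
  have h2 : 1 ≤ N.G.diam := Nat.one_le_iff_ne_zero.2
    (SimpleGraph.connected_iff_diam_ne_zero.1 N.conn)
  generalize N.G.diam = d at *
  generalize N.height = x at *
  have h3 : (3 * x + 3) * (x + 1) ≤ 12 * d ^ 2 := by nlinarith
  have h4 : 2 * x + 1 ≤ 3 * d ^ 2 := by nlinarith
  calc 2 * x + 1 + (3 * x + 3) * ((x + 1) * 2 ^ k)
      = 2 * x + 1 + ((3 * x + 3) * (x + 1)) * 2 ^ k := by ring
    _ ≤ 3 * d ^ 2 + (12 * d ^ 2) * 2 ^ k := Nat.add_le_add h4 (Nat.mul_le_mul_right _ h3)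
    _ = (3 + 12 * 2 ^ k) * d ^ 2 := by ring

end Network

theorem mainTheorem8 (k a : ℕ) :
    ∃ (A : CongestAlgorithm LocalInput SketchData) (c C : ℕ),
      ∀ (V : Type*) [Fintype V] (G T : SimpleGraph V) (r : V) (ident : V → ℕ),
        G.Connected → RootedTree.IsBFSTree G T r →
        Function.Injective ident →
        (∀ v, (ident v).size ≤ a * (Nat.log 2 (Fintype.card V) + 1)) →
        A.HasBandwidth G ident (localInput G T r ident)
            (c * (Nat.log 2 (Fintype.card V) + 1)) ∧
          A.ComputesWithin G ident (localInput G T r ident) (kSketch G T r ident k)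
            (C * G.diam ^ 2) := by
  refine ⟨historyAlgorithm
    (NodeState.blockSend (fun H => (H + 1) * 2 ^ k) fun i st => st.message k i)
    (NodeState.blockOut (fun H => (H + 1) * 2 ^ k) (fun H => 3 * H + 3)
      fun st => st.sketch k (3 * st.height + 2)),
    6 * (2 * (a + 3) + 1), 3 + 12 * 2 ^ k, ?_⟩
  intro V _ G T r ident hG hT hinj hid
  let N : Network := ⟨V, G, T, r, ident, hG, hT, hinj⟩
  exact Network.blockAlgorithm_correct (N := N) (Y := N.msgT k)
    (fun i _ v => Network.message_blockView i v) (fun v => Network.sketch_blockView v)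
    (fun i v => Network.nil_notMem_msgT i v) (fun i v => Network.card_msgT_le i v)
    (fun i v l hl => Network.length_encode_msgT_le hid hl)
    (fun t v => Network.length_encode_floodMsg_le a t v)
    (fun _ => Network.rounds_le)
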